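/- Let $p,q\ge 1$ be integers and let $(\overline M,\overline g,J)$ be a locally metallic Riemannian manifold: a smooth Riemannian manifold with a smooth $(1,1)$-tensor field $J$ such that $J^2=pJ+qI$, $\overline g(JX,Y)=\overline g(X,JY)$ and $\overline\nabla J=0$, where $\overline\nabla$ is the Levi-Civita connection of $\overline g$ (the case $p=q=1$ is the locally Golden case). Let $(M_\perp,g_1)$ and $(M_T,g_2)$ be smooth Riemannian manifolds, with $M_T$ non-empty and of positive dimension, let $f:M_\perp\to(0,\infty)$ be smooth, and let $M=M_\perp\times_f M_T$ be the warped product, i.e. the product manifold with the metric $\pi_1^*g_1+(f\circ\pi_1)^2\pi_2^*g_2$, where $\pi_1,\pi_2$ are the projections. Suppose that $M$ is isometrically immersed in $\overline M$ as a warped product semi-invariant submanifold: at each point of $M$, $J$ maps every vector tangent to the factor $M_T$ to a vector tangent to $M_T$ ($M_T$ is invariant), and maps every vector tangent to the factor $M_\perp$ to a vector orthogonal to $M_\perp$ ($M_\perp$ is anti-invariant). Vectors tangent to $M$ are identified with their images in $T\overline M$. Denote by $TU$ the tangential component of $JU$ for $U$ tangent to $M$, by $tV$ the tangential component of $JV$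 for $V$ normal to $M$, and let the shape operator $A_V$ and the normal connection $\nabla^\perp$ be given by the Weingarten formula $\overline\nabla_U V=-A_VU+\nabla^\perp_UV$, for $U$ tangent to $M$ and $V$ a normal field. Then $f$ is constant on every connected component of $M_\perp$ if and only if $$(T-pI)A_{JX}Z=-t\,\nabla^\perp_Z JX$$ at every point of $M$, for all smooth vector fields $X$ on $M_\perp$ and $Z$ on $M_T$, where $X$ and $Z$ also denote their lifts to $M$ and $I$ is the identity on tangent vectors of $M$. -/

import Mathlib

open Bundle Manifold
open scoped Manifold ContDiff Topology InnerProductSpace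

noncomputable section

namespace MetallicGeometry

section Ambient

/- A Riemannian manifold `M` without boundary, modelled on the finite dimensional space `E`; its
metric is the inner product `inner ℝ` carried by each tangent space. -/
variable {E : Type*} [NormedAddCommGroup E] [NormedSpace ℝ E] [FiniteDimensional ℝ E]
  {M : Type*} [TopologicalSpace M] [ChartedSpace E M] [IsManifold 𝓘(ℝ, E) ∞ M]

instance instFiniteDimensionalTangentSpace (x : M) :
    FiniteDimensional ℝ (TangentSpace 𝓘(ℝ, E) x) :=
  inferInstanceAs (FiniteDimensional ℝ E)

variable [RiemannianBundle (fun x : M ↦ TangentSpace 𝓘(ℝ, E) x)]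

variable (E) in
/-- The matrix of the metric at `y`, in the coordinate frame of the preferred chart at `x₀`:
the bilinear form `(a, b) ↦ ⟨∂_a, ∂_b⟩_y` on the model space, where `∂_a` is the coordinate vector
field with constant components `a`. -/
def metricCoeff (x₀ y : M) : E →L[ℝ] E →L[ℝ] ℝ :=
  (innerSL ℝ (E := TangentSpace 𝓘(ℝ, E) y)).bilinearComp
    ((trivializationAt E (TangentSpace 𝓘(ℝ, E) : M → Type _) x₀).symmL ℝ y)
    ((trivializationAt E (TangentSpace 𝓘(ℝ, E) : M → Type _) x₀).symmL ℝ y)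

variable (E) in
/-- The first derivatives at `x` of the metric coefficients in the preferred chart at `x`:
`metricCoeffDeriv E x v a b = ∂_v ⟨∂_a, ∂_b⟩ (x)`. -/
def metricCoeffDeriv (x : M) : E →L[ℝ] E →L[ℝ] E →L[ℝ] ℝ :=
  mvfderiv 𝓘(ℝ, E) (fun y : M ↦ metricCoeff E x y) x

/-- The Christoffel symbol of the first kind at `x`, as a linear form in the last slot:
`u ↦ (∂_v g(w,u) + ∂_w g(v,u) - ∂_u g(v,w)) / 2`. -/
def christoffelFirst (x : M) (v w : TangentSpace 𝓘(ℝ, E) x) :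
    TangentSpace 𝓘(ℝ, E) x →L[ℝ] ℝ :=
  (1 / 2 : ℝ) • (metricCoeffDeriv E x v w + metricCoeffDeriv E x w v
    - ((metricCoeffDeriv E x).flip v).flip w)

/-- The Christoffel symbol (of the second kind) `Γ_x(v, w)` of the Levi-Civita connection, in the
preferred chart at `x`: the vector with `⟨Γ_x(v,w), u⟩ = christoffelFirst x v w u` for all `u`. -/
def christoffel (x : M) (v w : TangentSpace 𝓘(ℝ, E) x) : TangentSpace 𝓘(ℝ, E) x :=
  (InnerProductSpace.toDual ℝ (TangentSpace 𝓘(ℝ, E) x)).symm (christoffelFirst x v w)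

/-- Covariant differentiation along a map `φ : N → M` by the Levi-Civita connection of `M`: for a
vector field `V` along `φ` (`V y` is tangent to `M` at `φ y`) and `z` tangent to `N` at `x`, this is
`∇_z V = dV(z) + Γ(dφ(z), V)`, computed in the preferred chart of `M` at `φ x`. (The trivialization
at `φ x` is the identity on the fibre over `φ x`.) -/
def covAlong {E' H' N : Type*} [NormedAddCommGroup E'] [NormedSpace ℝ E'] [TopologicalSpace H']
    (I' : ModelWithCorners ℝ E' H') [TopologicalSpace N] [ChartedSpace H' N]
    (φ : N → M) (V : Π y : N, TangentSpace 𝓘(ℝ, E) (φ y)) (x : N) (z : TangentSpace I' x) :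
    TangentSpace 𝓘(ℝ, E) (φ x) :=
  (show TangentSpace 𝓘(ℝ, E) (φ x) from mvfderiv I'
    (fun y : N ↦ (trivializationAt E (TangentSpace 𝓘(ℝ, E) : M → Type _) (φ x)
      (TotalSpace.mk' E (φ y) (V y))).2) x z)
  + christoffel (φ x) (mfderiv I' 𝓘(ℝ, E) φ x z) (V x)

/-- The Levi-Civita connection of `M`: `leviCivita Y x v` is `∇_v Y` at the point `x`. -/
def leviCivita (Y : Π x : M, TangentSpace 𝓘(ℝ, E) x) (x : M) (v : TangentSpace 𝓘(ℝ, E) x) :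
    TangentSpace 𝓘(ℝ, E) x :=
  covAlong 𝓘(ℝ, E) (fun y : M ↦ y) Y x v

/-- `J` is a metallic structure with parameters `p, q ∈ {1, 2, …}` on `M`, compatible with the
metric; that is, `(M, ⟨·,·⟩, J)` is a metallic Riemannian manifold. -/
structure IsMetallicRiemannian (p q : ℕ)
    (J : Π x : M, TangentSpace 𝓘(ℝ, E) x →L[ℝ] TangentSpace 𝓘(ℝ, E) x) : Prop where
  p_pos : 0 < p
  q_pos : 0 < q
  smooth : ContMDiff 𝓘(ℝ, E) (𝓘(ℝ, E).prod 𝓘(ℝ, E →L[ℝ] E)) ∞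
    (fun x : M ↦ (TotalSpace.mk' (E →L[ℝ] E) x (J x) :
      TotalSpace (E →L[ℝ] E) (fun x : M ↦ TangentSpace 𝓘(ℝ, E) x →L[ℝ] TangentSpace 𝓘(ℝ, E) x)))
  sq : ∀ (x : M) (v : TangentSpace 𝓘(ℝ, E) x), J x (J x v) = (p : ℝ) • J x v + (q : ℝ) • v
  symm : ∀ (x : M) (v w : TangentSpace 𝓘(ℝ, E) x), inner ℝ (J x v) w = inner ℝ v (J x w)

/-- A locally metallic Riemannian manifold: a metallic Riemannian manifold with `∇J = 0`, i.e.
`∇_v (J Y) = J (∇_v Y)` for every tangent vector `v` and every vector field `Y` differentiable at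
the base point of `v`. -/
structure IsLocallyMetallic (p q : ℕ)
    (J : Π x : M, TangentSpace 𝓘(ℝ, E) x →L[ℝ] TangentSpace 𝓘(ℝ, E) x) : Prop
    extends IsMetallicRiemannian p q J where
  parallel : ∀ (Y : Π x : M, TangentSpace 𝓘(ℝ, E) x) (x : M) (v : TangentSpace 𝓘(ℝ, E) x),
    MDifferentiableAt 𝓘(ℝ, E) (𝓘(ℝ, E).prod 𝓘(ℝ, E))
      (fun y : M ↦ (TotalSpace.mk' E y (Y y) : TangentBundle 𝓘(ℝ, E) M)) x →
    leviCivita (fun y ↦ J y (Y y)) x v = J x (leviCivita Y x v)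

section Submanifold

/- A manifold `N` mapped to `M` by `φ` (later: an isometric immersion). As usual the tangent space
of `N` at `x` is identified with its image in the tangent space of `M` at `φ x`. -/
variable {E' H' N : Type*} [NormedAddCommGroup E'] [NormedSpace ℝ E'] [TopologicalSpace H']
  (I' : ModelWithCorners ℝ E' H') [TopologicalSpace N] [ChartedSpace H' N]
  (φ : N → M)

variable (E) in
/-- The tangent space of the immersed submanifold at `x`, inside the ambient tangent space. -/
def tangentSub (x : N) : Submodule ℝ (TangentSpace 𝓘(ℝ, E) (φ x)) :=
  (mfderiv I' 𝓘(ℝ, E) φ x).range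

variable (E) in
/-- The normal space of the immersed submanifold at `x`. -/
def normalSub (x : N) : Submodule ℝ (TangentSpace 𝓘(ℝ, E) (φ x)) :=
  (tangentSub E I' φ x)ᗮ

/-- The tangential component of an ambient vector. -/
def tangentPart (x : N) (w : TangentSpace 𝓘(ℝ, E) (φ x)) : tangentSub E I' φ x :=
  (tangentSub E I' φ x).orthogonalProjectionOnto w

/-- The normal component of an ambient vector. -/
def normalPart (x : N) (w : TangentSpace 𝓘(ℝ, E) (φ x)) : normalSub E I' φ x :=
  (normalSub E I' φ x).orthogonalProjectionOnto w

/-- The operator `T` on tangent vectors: the tangential component of `J X`. -/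
def opT (J : Π x : M, TangentSpace 𝓘(ℝ, E) x →L[ℝ] TangentSpace 𝓘(ℝ, E) x) (x : N)
    (u : tangentSub E I' φ x) : tangentSub E I' φ x :=
  tangentPart I' φ x (J (φ x) u)

/-- The operator `t` on normal vectors: the tangential component of `J V`. -/
def opt (J : Π x : M, TangentSpace 𝓘(ℝ, E) x →L[ℝ] TangentSpace 𝓘(ℝ, E) x) (x : N)
    (v : normalSub E I' φ x) : tangentSub E I' φ x :=
  tangentPart I' φ x (J (φ x) v)

/-- The shape operator `A_V z = -(∇_z V)^⊤` for a normal vector field `V`, as in the Weingarten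
formula `∇_z V = -A_V z + ∇^⊥_z V`. -/
def shapeOperator (V : Π y : N, TangentSpace 𝓘(ℝ, E) (φ y)) (x : N) (z : TangentSpace I' x) :
    tangentSub E I' φ x :=
  -tangentPart I' φ x (covAlong I' φ V x z)

/-- The normal connection `∇^⊥_z V = (∇_z V)^⊥` for a normal vector field `V`. -/
def normalConnection (V : Π y : N, TangentSpace 𝓘(ℝ, E) (φ y)) (x : N) (z : TangentSpace I' x) :
    normalSub E I' φ x :=
  normalPart I' φ x (covAlong I' φ V x z)

end Submanifold

end Ambient

section Warped

variable {E₁ : Type*} [NormedAddCommGroup E₁] [NormedSpace ℝ E₁]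
  {E₂ : Type*} [NormedAddCommGroup E₂] [NormedSpace ℝ E₂]
  {M₁ : Type*} [TopologicalSpace M₁] [ChartedSpace E₁ M₁]
  {M₂ : Type*} [TopologicalSpace M₂] [ChartedSpace E₂ M₂]

/-- The lift to `M₁ × M₂` of a vector field on `M₁` (the horizontal lift). -/
def liftFst (X : Π x : M₁, TangentSpace 𝓘(ℝ, E₁) x) (x : M₁ × M₂) :
    TangentSpace (𝓘(ℝ, E₁).prod 𝓘(ℝ, E₂)) x :=
  mfderiv 𝓘(ℝ, E₁) (𝓘(ℝ, E₁).prod 𝓘(ℝ, E₂)) (fun y : M₁ ↦ (y, x.2)) x.1 (X x.1)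

/-- The lift to `M₁ × M₂` of a vector field on `M₂` (the vertical lift). -/
def liftSnd (Z : Π x : M₂, TangentSpace 𝓘(ℝ, E₂) x) (x : M₁ × M₂) :
    TangentSpace (𝓘(ℝ, E₁).prod 𝓘(ℝ, E₂)) x :=
  mfderiv 𝓘(ℝ, E₂) (𝓘(ℝ, E₁).prod 𝓘(ℝ, E₂)) (fun y : M₂ ↦ (x.1, y)) x.2 (Z x.2)

/-- The warped product metric `π₁^* g₁ + (f ∘ π₁)² π₂^* g₂` on `M₁ × M₂`. -/
def warpedMetric [RiemannianBundle (fun x : M₁ ↦ TangentSpace 𝓘(ℝ, E₁) x)]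
    [RiemannianBundle (fun x : M₂ ↦ TangentSpace 𝓘(ℝ, E₂) x)] (f : M₁ → ℝ) (x : M₁ × M₂)
    (u v : TangentSpace (𝓘(ℝ, E₁).prod 𝓘(ℝ, E₂)) x) : ℝ :=
  inner ℝ (mfderiv (𝓘(ℝ, E₁).prod 𝓘(ℝ, E₂)) 𝓘(ℝ, E₁) Prod.fst x u)
      (mfderiv (𝓘(ℝ, E₁).prod 𝓘(ℝ, E₂)) 𝓘(ℝ, E₁) Prod.fst x v)
    + f x.1 ^ 2 * inner ℝ (mfderiv (𝓘(ℝ, E₁).prod 𝓘(ℝ, E₂)) 𝓘(ℝ, E₂) Prod.snd x u)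
      (mfderiv (𝓘(ℝ, E₁).prod 𝓘(ℝ, E₂)) 𝓘(ℝ, E₂) Prod.snd x v)

variable {E : Type*} [NormedAddCommGroup E] [NormedSpace ℝ E]
  {M : Type*} [TopologicalSpace M] [ChartedSpace E M]

variable (E E₁) in
/-- The tangent space at `x` to the first factor of `M₁ × M₂`, seen in the ambient manifold through
`φ : M₁ × M₂ → M`. -/
def tangentFst (φ : M₁ × M₂ → M) (x : M₁ × M₂) : Submodule ℝ (TangentSpace 𝓘(ℝ, E) (φ x)) :=
  (mfderiv 𝓘(ℝ, E₁) 𝓘(ℝ, E) (fun y : M₁ ↦ φ (y, x.2)) x.1).range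

variable (E E₂) in
/-- The tangent space at `x` to the second factor of `M₁ × M₂`, seen in the ambient manifold through
`φ : M₁ × M₂ → M`. -/
def tangentSnd (φ : M₁ × M₂ → M) (x : M₁ × M₂) : Submodule ℝ (TangentSpace 𝓘(ℝ, E) (φ x)) :=
  (mfderiv 𝓘(ℝ, E₂) 𝓘(ℝ, E) (fun y : M₂ ↦ φ (x.1, y)) x.2).range

variable (E₁ E₂) in
/-- `φ` makes the warped product `M₁ ×_f M₂` a warped product semi-invariant submanifold
`M_⊥ ×_f M_T` of `(M, ⟨·,·⟩, J)`: `f` is a smooth positive function on `M₁`, `φ` is a smooth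
isometric map from the warped product into `M` (hence an immersion, the warped metric being positive
definite), the first factor is anti-invariant (`J` maps its tangent vectors to vectors orthogonal
to it) and the second factor is invariant. -/
structure IsWarpedSemiInvariant [RiemannianBundle (fun x : M ↦ TangentSpace 𝓘(ℝ, E) x)]
    [RiemannianBundle (fun x : M₁ ↦ TangentSpace 𝓘(ℝ, E₁) x)]
    [RiemannianBundle (fun x : M₂ ↦ TangentSpace 𝓘(ℝ, E₂) x)]
    (J : Π x : M, TangentSpace 𝓘(ℝ, E) x →L[ℝ] TangentSpace 𝓘(ℝ, E) x)
    (f : M₁ → ℝ) (φ : M₁ × M₂ → M) : Prop where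
  smooth_warping : ContMDiff 𝓘(ℝ, E₁) 𝓘(ℝ, ℝ) ∞ f
  warping_pos : ∀ x, 0 < f x
  smooth : ContMDiff (𝓘(ℝ, E₁).prod 𝓘(ℝ, E₂)) 𝓘(ℝ, E) ∞ φ
  isometric : ∀ (x : M₁ × M₂) (u v : TangentSpace (𝓘(ℝ, E₁).prod 𝓘(ℝ, E₂)) x),
    inner ℝ (mfderiv (𝓘(ℝ, E₁).prod 𝓘(ℝ, E₂)) 𝓘(ℝ, E) φ x u)
      (mfderiv (𝓘(ℝ, E₁).prod 𝓘(ℝ, E₂)) 𝓘(ℝ, E) φ x v) = warpedMetric f x u v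
  antiInvariant : ∀ (x : M₁ × M₂), ∀ v ∈ tangentFst E₁ E φ x,
    J (φ x) v ∈ (tangentFst E₁ E φ x)ᗮ
  invariant : ∀ (x : M₁ × M₂), ∀ v ∈ tangentSnd E₂ E φ x, J (φ x) v ∈ tangentSnd E₂ E φ x

end Warped

end MetallicGeometry

end

set_option linter.unusedSectionVars false
set_option synthInstance.maxHeartbeats 100000

noncomputable section

namespace MetallicGeometry

/-! ### Normed structure on bilinear forms, the space in which metric coefficients take values. -/

section Instances

variable {E : Type*} [NormedAddCommGroup E] [NormedSpace ℝ E]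

/-! For `X` on `M_⊥` and `Z` on `M_T`, put `w = ∇̄_Z X`, the ambient derivative of `X` along `Z`,
and `c = X(f)/f`. Three facts determine everything. By the Koszul formula for the metric `g₁ + f²
g₂`, `w` is orthogonal to `M_⊥` (`inner_covAlong_fst`), and its products with `M_T` are those of
`cZ` (`inner_covAlong_snd`); hence `w^⊤ = cZ`. Moreover `w` is orthogonal to `J(TM_⊥)`
(`inner_covAlong_map_fst`): by symmetry of second derivatives, `∇̄J = 0` and self-adjointness,
`⟨∇̄_Z X, JY⟩ = ⟨∇̄_X(JZ), Y⟩ = X⟨JZ, Y⟩ - ⟨JZ, ∇̄_X Y⟩`, and both terms vanish because `JZ` is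
tangent to `M_T` and the leaves of `M_⊥` are totally geodesic in `M`.

Since `J` is parallel, `∇̄_Z(JX) = Jw`, and the third fact yields `(Jw)^⊤ = cJZ`. Thus `A_{JX}Z =
-cJZ`, and `J² = pJ + q` gives `(T - pI)A_{JX}Z + t∇^⊥_Z JX = -qcZ` (`weingarten_sum_eq`). As `q`
and `f` do not vanish, the condition says at each point that `X(f) = 0` or `Z = 0`
(`shapeOperator_condition_iff`). Tangent vectors extend to global smooth fields and `M_T` carries
nonzero vectors, so the condition for all `X`, `Z` means `df = 0`, that is, `f` is constant on
components.

The metric identities are proved in the model vector spaces for constant fields and then carried to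
the manifolds through the preferred charts. -/

instance instNormedAddCommGroupBilin : NormedAddCommGroup (E →L[ℝ] E →L[ℝ] ℝ) :=
  ContinuousLinearMap.toNormedAddCommGroup

instance instNormedSpaceBilin : NormedSpace ℝ (E →L[ℝ] E →L[ℝ] ℝ) :=
  ContinuousLinearMap.toNormedSpace

instance instAddCommGroupBilin : AddCommGroup (E →L[ℝ] E →L[ℝ] ℝ) :=
  ContinuousLinearMap.addCommGroup

end Instances

/-! ### Christoffel symbols and the Koszul formula in a vector space. -/

section Model

variable {F : Type*} [NormedAddCommGroup F] [NormedSpace ℝ F]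
  {E : Type*} [NormedAddCommGroup E] [NormedSpace ℝ E]

/-- `C` is the Levi-Civita Christoffel symbol at `e` of the metric with coefficients `G`. -/
structure IsChristoffelAt (G : E → E →L[ℝ] E →L[ℝ] ℝ) (e : E) (C : E → E → E) : Prop where
  symm : ∀ v w, C v w = C w v
  koszul : ∀ v w u, 2 * G e (C v w) u =
    fderiv ℝ G e v w u + fderiv ℝ G e w v u - fderiv ℝ G e u v w

theorem fderiv_bilin_symm {G : E → E →L[ℝ] E →L[ℝ] ℝ} {e : E} (hG : DifferentiableAt ℝ G e)
    (hsymm : ∀ e a b, G e a b = G e b a) (v a b : E) :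
    fderiv ℝ G e v a b = fderiv ℝ G e v b a := by
  have h1 := (hG.hasFDerivAt.clm_apply (hasFDerivAt_const a e)).clm_apply
    (hasFDerivAt_const b e)
  have h2 := (hG.hasFDerivAt.clm_apply (hasFDerivAt_const b e)).clm_apply
    (hasFDerivAt_const a e)
  have h3 : (fun e ↦ G e a b) = fun e ↦ G e b a := funext fun e ↦ hsymm e a b
  rw [h3] at h1
  simpa using DFunLike.congr_fun (h1.unique h2) v

/-- Adding the Koszul identities for `(v, a, b)` and `(v, b, a)` cancels the derivatives in the
directions `a` and `b`, by symmetry of the metric. -/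
theorem IsChristoffelAt.add_eq {G : E → E →L[ℝ] E →L[ℝ] ℝ} {e : E} {C : E → E → E}
    (hC : IsChristoffelAt G e C) (hG : DifferentiableAt ℝ G e)
    (hsymm : ∀ e a b, G e a b = G e b a) (v a b : E) :
    G e (C v a) b + G e a (C v b) = fderiv ℝ G e v a b := by
  have hflip := fderiv_bilin_symm hG hsymm
  have h1 := hC.koszul v a b
  have h2 := hC.koszul v b a
  rw [hsymm e a (C v b)]
  have h3 := hflip v a b
  have h4 := hflip a v b
  have h5 := hflip b v a
  have h6 := hflip a b v
  linarith

/-- Compatibility with the metric, along a map `ψ`. -/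
theorem IsChristoffelAt.hasFDerivAt_inner {G : E → E →L[ℝ] E →L[ℝ] ℝ} {ψ V W : F → E} {s : F}
    {C : E → E → E} (hC : IsChristoffelAt G (ψ s) C) (hG : DifferentiableAt ℝ G (ψ s))
    (hsymm : ∀ e a b, G e a b = G e b a) (hψ : DifferentiableAt ℝ ψ s)
    (hV : DifferentiableAt ℝ V s) (hW : DifferentiableAt ℝ W s) (ζ : F) :
    fderiv ℝ (fun r ↦ G (ψ r) (V r) (W r)) s ζ =
      G (ψ s) (fderiv ℝ V s ζ + C (fderiv ℝ ψ s ζ) (V s)) (W s)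
        + G (ψ s) (V s) (fderiv ℝ W s ζ + C (fderiv ℝ ψ s ζ) (W s)) := by
  have h1 : HasFDerivAt (fun r ↦ G (ψ r)) ((fderiv ℝ G (ψ s)).comp (fderiv ℝ ψ s)) s :=
    HasFDerivAt.comp (g := G) s hG.hasFDerivAt hψ.hasFDerivAt
  have h2 := (h1.clm_apply hV.hasFDerivAt).clm_apply hW.hasFDerivAt
  rw [h2.fderiv]
  have h3 := hC.add_eq hG hsymm (fderiv ℝ ψ s ζ) (V s) (W s)
  simp only [map_add, add_apply, ContinuousLinearMap.comp_apply,
    ContinuousLinearMap.flip_apply]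
  linarith

/-- The second covariant derivative `∇_v (dψ w)` of a map `ψ`, for constant fields `v`, `w`. -/
def secondCov (C : E → E → E) (ψ : F → E) (s v w : F) : E :=
  fderiv ℝ (fun r ↦ fderiv ℝ ψ r w) s v + C (fderiv ℝ ψ s v) (fderiv ℝ ψ s w)

theorem differentiableAt_fderiv_apply {ψ : F → E} {s : F} (hψ : ContDiffAt ℝ 2 ψ s) (w : F) :
    DifferentiableAt ℝ (fun r ↦ fderiv ℝ ψ r w) s := by
  have h : ContDiffAt ℝ 1 (fderiv ℝ ψ) s := hψ.fderiv_right (by norm_num)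
  exact (h.differentiableAt (by norm_num)).clm_apply (differentiableAt_const w)

theorem fderiv_fderiv_apply {ψ : F → E} {s : F} (hψ : ContDiffAt ℝ 2 ψ s) (v w : F) :
    fderiv ℝ (fun r ↦ fderiv ℝ ψ r w) s v = fderiv ℝ (fderiv ℝ ψ) s v w := by
  have h : ContDiffAt ℝ 1 (fderiv ℝ ψ) s := hψ.fderiv_right (by norm_num)
  have h2 := ((h.differentiableAt (by norm_num)).hasFDerivAt.clm_apply (hasFDerivAt_const w s))
  rw [h2.fderiv]
  simp

/-- Absence of torsion: both the second derivative of `ψ` and the Christoffel symbol are symmetric.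
-/
theorem IsChristoffelAt.secondCov_symm {G : E → E →L[ℝ] E →L[ℝ] ℝ} {ψ : F → E} {s : F}
    {C : E → E → E} (hC : IsChristoffelAt G (ψ s) C) (hψ : ContDiffAt ℝ 2 ψ s) (v w : F) :
    secondCov C ψ s v w = secondCov C ψ s w v := by
  have h : IsSymmSndFDerivAt ℝ ψ s := hψ.isSymmSndFDerivAt (by simp)
  rw [secondCov, secondCov, fderiv_fderiv_apply hψ, fderiv_fderiv_apply hψ, h.eq, hC.symm]

/-- The Koszul formula for the metric induced by `ψ`, for constant vector fields. -/
theorem IsChristoffelAt.koszul_secondCov {G : E → E →L[ℝ] E →L[ℝ] ℝ} {ψ : F → E} {s : F}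
    {C : E → E → E} (hC : IsChristoffelAt G (ψ s) C) (hG : DifferentiableAt ℝ G (ψ s))
    (hsymm : ∀ e a b, G e a b = G e b a) (hψ : ContDiffAt ℝ 2 ψ s) (v w u : F) :
    2 * G (ψ s) (secondCov C ψ s v w) (fderiv ℝ ψ s u) =
      fderiv ℝ (fun r ↦ G (ψ r) (fderiv ℝ ψ r w) (fderiv ℝ ψ r u)) s v
      + fderiv ℝ (fun r ↦ G (ψ r) (fderiv ℝ ψ r v) (fderiv ℝ ψ r u)) s w
      - fderiv ℝ (fun r ↦ G (ψ r) (fderiv ℝ ψ r v) (fderiv ℝ ψ r w)) s u := by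
  have hd := fun w ↦ differentiableAt_fderiv_apply hψ w
  have hψ' := hψ.differentiableAt (by norm_num)
  rw [hC.hasFDerivAt_inner hG hsymm hψ' (hd w) (hd u),
    hC.hasFDerivAt_inner hG hsymm hψ' (hd v) (hd u),
    hC.hasFDerivAt_inner hG hsymm hψ' (hd v) (hd w)]
  have e1 := hC.secondCov_symm hψ v w
  have e2 := hC.secondCov_symm hψ v u
  have e3 := hC.secondCov_symm hψ w u
  have key : ∀ a b, fderiv ℝ (fun r ↦ fderiv ℝ ψ r b) s a + C (fderiv ℝ ψ s a) (fderiv ℝ ψ s b)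
    = secondCov C ψ s a b := fun a b ↦ rfl
  simp only [key]
  -- Metric compatibility has produced six terms; after symmetrizing the second covariant
  -- derivatives, four cancel and the other two coincide.
  rw [← e1, ← e2, ← e3, hsymm _ (fderiv ℝ ψ s w) (secondCov C ψ s v u),
    hsymm _ (fderiv ℝ ψ s v) (secondCov C ψ s w u)]
  ring

end Model

/-! ### Second covariant derivatives of a warped product immersion, in coordinates. -/

section WarpedModel

variable {E₁ : Type*} [NormedAddCommGroup E₁] [NormedSpace ℝ E₁]
  {E₂ : Type*} [NormedAddCommGroup E₂] [NormedSpace ℝ E₂]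
  {E : Type*} [NormedAddCommGroup E] [NormedSpace ℝ E]

/-- Near `s`, the metric induced by `ψ` is the warped product metric `g₁ + h g₂`. -/
def IsWarpedNear (G : E → E →L[ℝ] E →L[ℝ] ℝ) (ψ : E₁ × E₂ → E) (s : E₁ × E₂)
    (g₁ : E₁ → E₁ →L[ℝ] E₁ →L[ℝ] ℝ) (g₂ : E₂ → E₂ →L[ℝ] E₂ →L[ℝ] ℝ) (h : E₁ → ℝ) : Prop :=
  ∀ᶠ r in 𝓝 s, ∀ u v : E₁ × E₂, G (ψ r) (fderiv ℝ ψ r u) (fderiv ℝ ψ r v) =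
    g₁ r.1 u.1 v.1 + h r.1 * g₂ r.2 u.2 v.2

variable {G : E → E →L[ℝ] E →L[ℝ] ℝ} {ψ : E₁ × E₂ → E} {s : E₁ × E₂}
  {g₁ : E₁ → E₁ →L[ℝ] E₁ →L[ℝ] ℝ} {g₂ : E₂ → E₂ →L[ℝ] E₂ →L[ℝ] ℝ} {h : E₁ → ℝ}
  {C : E → E → E}

theorem IsWarpedNear.fderiv_eq (hw : IsWarpedNear G ψ s g₁ g₂ h)
    (hg₁ : DifferentiableAt ℝ g₁ s.1) (hg₂ : DifferentiableAt ℝ g₂ s.2)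
    (hh : DifferentiableAt ℝ h s.1) (u v ζ : E₁ × E₂) :
    fderiv ℝ (fun r ↦ G (ψ r) (fderiv ℝ ψ r u) (fderiv ℝ ψ r v)) s ζ =
      fderiv ℝ g₁ s.1 ζ.1 u.1 v.1 + fderiv ℝ h s.1 ζ.1 * g₂ s.2 u.2 v.2
        + h s.1 * fderiv ℝ g₂ s.2 ζ.2 u.2 v.2 := by
  have e1 : (fun r ↦ G (ψ r) (fderiv ℝ ψ r u) (fderiv ℝ ψ r v)) =ᶠ[𝓝 s]
      fun r ↦ g₁ r.1 u.1 v.1 + h r.1 * g₂ r.2 u.2 v.2 := by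
    filter_upwards [hw] with r hr using hr u v
  rw [e1.fderiv_eq]
  have p₁ : HasFDerivAt Prod.fst (ContinuousLinearMap.fst ℝ E₁ E₂) s := hasFDerivAt_fst
  have p₂ : HasFDerivAt Prod.snd (ContinuousLinearMap.snd ℝ E₁ E₂) s := hasFDerivAt_snd
  have h1 : HasFDerivAt (fun r : E₁ × E₂ ↦ g₁ r.1) _ s :=
    HasFDerivAt.comp (g := g₁) s hg₁.hasFDerivAt p₁
  have h2 : HasFDerivAt (fun r : E₁ × E₂ ↦ g₂ r.2) _ s :=
    HasFDerivAt.comp (g := g₂) s hg₂.hasFDerivAt p₂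
  have h3 : HasFDerivAt (fun r : E₁ × E₂ ↦ h r.1) _ s :=
    HasFDerivAt.comp (g := h) s hh.hasFDerivAt p₁
  have c₁ := fun u : E₁ ↦ hasFDerivAt_const (𝕜 := ℝ) u s
  have c₂ := fun u : E₂ ↦ hasFDerivAt_const (𝕜 := ℝ) u s
  have h4 := ((h1.clm_apply (c₁ u.1)).clm_apply (c₁ v.1)).add
    (h3.mul ((h2.clm_apply (c₂ u.2)).clm_apply (c₂ v.2)))
  rw [HasFDerivAt.fderiv (f := fun r : E₁ × E₂ ↦ g₁ r.1 u.1 v.1 + h r.1 * g₂ r.2 u.2 v.2) h4]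
  simp
  ring

/-- Every Koszul term vanishes: the two factors are orthogonal, and the products within the first
factor do not vary along the second. -/
theorem IsWarpedNear.secondCov_fst (hw : IsWarpedNear G ψ s g₁ g₂ h)
    (hg₁ : DifferentiableAt ℝ g₁ s.1) (hg₂ : DifferentiableAt ℝ g₂ s.2)
    (hh : DifferentiableAt ℝ h s.1) (hC : IsChristoffelAt G (ψ s) C)
    (hG : DifferentiableAt ℝ G (ψ s)) (hsymm : ∀ e a b, G e a b = G e b a)
    (hψ : ContDiffAt ℝ 2 ψ s) (z : E₂) (x y : E₁) :
    G (ψ s) (secondCov C ψ s (0, z) (x, 0)) (fderiv ℝ ψ s (y, 0)) = 0 := by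
  have := hC.koszul_secondCov hG hsymm hψ (0, z) (x, 0) (y, 0)
  rw [hw.fderiv_eq hg₁ hg₂ hh, hw.fderiv_eq hg₁ hg₂ hh, hw.fderiv_eq hg₁ hg₂ hh] at this
  simpa using this

/-- The only surviving Koszul term is the derivative of `h g₂(z, u)` in the direction `x`, which
acts on `h` alone. -/
theorem IsWarpedNear.secondCov_snd (hw : IsWarpedNear G ψ s g₁ g₂ h)
    (hg₁ : DifferentiableAt ℝ g₁ s.1) (hg₂ : DifferentiableAt ℝ g₂ s.2)
    (hh : DifferentiableAt ℝ h s.1) (hC : IsChristoffelAt G (ψ s) C)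
    (hG : DifferentiableAt ℝ G (ψ s)) (hsymm : ∀ e a b, G e a b = G e b a)
    (hψ : ContDiffAt ℝ 2 ψ s) (z u : E₂) (x : E₁) :
    2 * G (ψ s) (secondCov C ψ s (0, z) (x, 0)) (fderiv ℝ ψ s (0, u)) =
      fderiv ℝ h s.1 x * g₂ s.2 z u := by
  have := hC.koszul_secondCov hG hsymm hψ (0, z) (x, 0) (0, u)
  rw [hw.fderiv_eq hg₁ hg₂ hh, hw.fderiv_eq hg₁ hg₂ hh, hw.fderiv_eq hg₁ hg₂ hh] at this
  simpa using this

/-- The leaves of the first factor are totally geodesic in the warped product. -/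
theorem IsWarpedNear.secondCov_fst_fst (hw : IsWarpedNear G ψ s g₁ g₂ h)
    (hg₁ : DifferentiableAt ℝ g₁ s.1) (hg₂ : DifferentiableAt ℝ g₂ s.2)
    (hh : DifferentiableAt ℝ h s.1) (hC : IsChristoffelAt G (ψ s) C)
    (hG : DifferentiableAt ℝ G (ψ s)) (hsymm : ∀ e a b, G e a b = G e b a)
    (hψ : ContDiffAt ℝ 2 ψ s) (x y : E₁) (u : E₂) :
    G (ψ s) (secondCov C ψ s (x, 0) (y, 0)) (fderiv ℝ ψ s (0, u)) = 0 := by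
  have := hC.koszul_secondCov hG hsymm hψ (x, 0) (y, 0) (0, u)
  rw [hw.fderiv_eq hg₁ hg₂ hh, hw.fderiv_eq hg₁ hg₂ hh, hw.fderiv_eq hg₁ hg₂ hh] at this
  simpa using this

/-- If `J` is parallel, self-adjoint and preserves the second factor, then the mixed second
covariant derivative is orthogonal to the image under `J` of the first factor. -/
theorem IsWarpedNear.secondCov_map_fst (hw : IsWarpedNear G ψ s g₁ g₂ h)
    (hg₁ : DifferentiableAt ℝ g₁ s.1) (hg₂ : DifferentiableAt ℝ g₂ s.2)
    (hh : DifferentiableAt ℝ h s.1) (hC : IsChristoffelAt G (ψ s) C)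
    (hG : DifferentiableAt ℝ G (ψ s)) (hsymm : ∀ e a b, G e a b = G e b a)
    (hψ : ContDiffAt ℝ 2 ψ s) {J : E → E →L[ℝ] E} (hJ : DifferentiableAt ℝ J (ψ s))
    (hpar : ∀ v a, fderiv ℝ J (ψ s) v a + C v (J (ψ s) a) = J (ψ s) (C v a))
    (hadj : ∀ a b, G (ψ s) (J (ψ s) a) b = G (ψ s) a (J (ψ s) b))
    (hinv : ∀ z : E₂, ∃ u : E₂, J (ψ s) (fderiv ℝ ψ s (0, z)) = fderiv ℝ ψ s (0, u))
    (horth : ∀ᶠ r in 𝓝 s, ∀ (z : E₂) (y : E₁),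
      G (ψ r) (J (ψ r) (fderiv ℝ ψ r (0, z))) (fderiv ℝ ψ r (y, 0)) = 0)
    (z : E₂) (x y : E₁) :
    G (ψ s) (secondCov C ψ s (0, z) (x, 0)) (J (ψ s) (fderiv ℝ ψ s (y, 0))) = 0 := by
  have hψ' := hψ.differentiableAt (by norm_num)
  have hJz : HasFDerivAt (fun r ↦ J (ψ r) (fderiv ℝ ψ r (0, z))) _ s :=
    (HasFDerivAt.comp (g := J) s hJ.hasFDerivAt hψ'.hasFDerivAt).clm_apply
      (differentiableAt_fderiv_apply hψ (0, z)).hasFDerivAt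
  -- Differentiate the identity `⟨JZ, Y⟩ = 0`, valid near `s`, in the direction `X`.
  have hm := hC.hasFDerivAt_inner hG hsymm hψ' hJz.differentiableAt
    (differentiableAt_fderiv_apply hψ (y, 0)) (x, 0)
  have e0 : (fun r ↦ G (ψ r) (J (ψ r) (fderiv ℝ ψ r (0, z))) (fderiv ℝ ψ r (y, 0))) =ᶠ[𝓝 s]
      fun _ ↦ 0 := by
    filter_upwards [horth] with r hr using hr z y
  rw [e0.fderiv_eq] at hm
  obtain ⟨u, hu⟩ := hinv z
  -- At `s` the vector `JZ` is tangent to the second factor, so `⟨JZ, ∇_X Y⟩ = 0` and only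
  -- `⟨∇_X(JZ), Y⟩` is left.
  have e1 := hw.secondCov_fst_fst hg₁ hg₂ hh hC hG hsymm hψ x y u
  rw [secondCov, ← hu, hsymm] at e1
  rw [e1, hJz.fderiv] at hm
  -- Turn the goal `⟨∇_Z X, JY⟩ = 0` into `⟨J ∇_X Z, Y⟩ = 0`; parallelism of `J` then identifies `J
  -- ∇_X Z` with `∇_X(JZ)`.
  rw [hC.secondCov_symm hψ, ← hadj]
  have e2 := hpar (fderiv ℝ ψ s (x, 0)) (fderiv ℝ ψ s (0, z))
  have e3 : J (ψ s) (secondCov C ψ s (x, 0) (0, z)) =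
      J (ψ s) (fderiv ℝ (fun r ↦ fderiv ℝ ψ r (0, z)) s (x, 0))
      + (fderiv ℝ J (ψ s) (fderiv ℝ ψ s (x, 0)) (fderiv ℝ ψ s (0, z))
        + C (fderiv ℝ ψ s (x, 0)) (J (ψ s) (fderiv ℝ ψ s (0, z)))) := by
    rw [e2, secondCov, map_add]
  rw [e3]
  simp only [add_apply, ContinuousLinearMap.comp_apply,
    ContinuousLinearMap.flip_apply, fderiv_fun_const, Pi.zero_apply,
    zero_apply, add_zero, add_assoc] at hm
  exact hm.symm

end WarpedModel

/-! ### Derivatives of vector-valued functions in charts. -/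

section Charts

variable {E' H' N : Type*} [NormedAddCommGroup E'] [NormedSpace ℝ E'] [TopologicalSpace H']
  {I' : ModelWithCorners ℝ E' H'} [I'.Boundaryless] [TopologicalSpace N] [ChartedSpace H' N]
  {V : Type*} [NormedAddCommGroup V] [NormedSpace ℝ V]

theorem differentiableAt_comp_extChartAt_symm {g : N → V} {x : N}
    (hg : MDifferentiableAt I' 𝓘(ℝ, V) g x) :
    DifferentiableAt ℝ (g ∘ (extChartAt I' x).symm) (extChartAt I' x x) := by
  have h := hg.differentiableWithinAt_writtenInExtChartAt
  rwa [I'.range_eq_univ, differentiableWithinAt_univ] at h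

theorem mvfderiv_apply_eq_fderiv {g : N → V} {x : N} (hg : MDifferentiableAt I' 𝓘(ℝ, V) g x)
    (z : TangentSpace I' x) :
    mvfderiv I' g x z = fderiv ℝ (g ∘ (extChartAt I' x).symm) (extChartAt I' x x) z := by
  have h : fderivWithin ℝ (g ∘ (extChartAt I' x).symm) (Set.range I') (extChartAt I' x x) =
      fderiv ℝ (g ∘ (extChartAt I' x).symm) (extChartAt I' x x) := by
    rw [I'.range_eq_univ, fderivWithin_univ]
  exact (DFunLike.congr_fun hg.mfderiv z).trans (DFunLike.congr_fun h z)
end Charts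

/-! ### The metric and its Christoffel symbol in the preferred chart. -/

section Ambient

variable {E : Type*} [NormedAddCommGroup E] [NormedSpace ℝ E] [FiniteDimensional ℝ E]
  {M : Type*} [TopologicalSpace M] [ChartedSpace E M] [IsManifold 𝓘(ℝ, E) ∞ M]

theorem symmL_trivializationAt_self (x : M) (a : E) :
    (trivializationAt E (TangentSpace 𝓘(ℝ, E) : M → Type _) x).symmL ℝ x a = a := by
  rw [TangentBundle.symmL_trivializationAt_eq_core (mem_chart_source E x)]
  exact (tangentBundleCore 𝓘(ℝ, E) M).coordChange_self (achart E x) x (mem_chart_source E x) a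

theorem continuousLinearMapAt_trivializationAt_self (x : M) (a : TangentSpace 𝓘(ℝ, E) x) :
    (trivializationAt E (TangentSpace 𝓘(ℝ, E) : M → Type _) x).continuousLinearMapAt ℝ x a = a := by
  rw [TangentBundle.continuousLinearMapAt_trivializationAt_eq_core (mem_chart_source E x)]
  exact (tangentBundleCore 𝓘(ℝ, E) M).coordChange_self (achart E x) x (mem_chart_source E x) a

variable [RiemannianBundle (fun x : M ↦ TangentSpace 𝓘(ℝ, E) x)]

theorem metricCoeff_apply (x₀ y : M) (a b : E) :
    metricCoeff E x₀ y a b =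
      inner ℝ ((trivializationAt E (TangentSpace 𝓘(ℝ, E) : M → Type _) x₀).symmL ℝ y a)
        ((trivializationAt E (TangentSpace 𝓘(ℝ, E) : M → Type _) x₀).symmL ℝ y b) := rfl

theorem metricCoeff_symm (x₀ y : M) (a b : E) :
    metricCoeff E x₀ y a b = metricCoeff E x₀ y b a := by
  rw [metricCoeff_apply, metricCoeff_apply, real_inner_comm]

theorem metricCoeff_self (x : M) (a b : TangentSpace 𝓘(ℝ, E) x) :
    metricCoeff E x x a b = inner ℝ a b :=
  (metricCoeff_apply (E := E) x x a b).trans (congrArg₂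
    (fun v w : TangentSpace 𝓘(ℝ, E) x ↦ inner ℝ v w)
    (symmL_trivializationAt_self (E := E) x a)
    (symmL_trivializationAt_self (E := E) x b))

variable [IsContMDiffRiemannianBundle 𝓘(ℝ, E) ∞ E (fun x : M ↦ TangentSpace 𝓘(ℝ, E) x)]

/-- Smoothness of the metric is given for a section of the bundle of bilinear forms; near `x` its
trivialized coordinates are exactly the metric coefficients. -/
theorem mdifferentiableAt_metricCoeff (x : M) :
    MDifferentiableAt 𝓘(ℝ, E) 𝓘(ℝ, E →L[ℝ] E →L[ℝ] ℝ) (metricCoeff E x) x := by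
  obtain ⟨g, hg, hg'⟩ := IsContMDiffRiemannianBundle.exists_contMDiff (IB := 𝓘(ℝ, E)) (n := ∞)
    (F := E) (E := fun x : M ↦ TangentSpace 𝓘(ℝ, E) x)
  have h := ((contMDiffAt_section x).1 (hg x)).mdifferentiableAt (by simp)
  refine h.congr_of_eventuallyEq ?_
  filter_upwards [(trivializationAt E (TangentSpace 𝓘(ℝ, E) : M → Type _) x).open_baseSet.mem_nhds
    (FiberBundle.mem_baseSet_trivializationAt' x)] with y hy
  ext a b
  rw [metricCoeff_apply, hg']
  simp [hom_trivializationAt_apply, ContinuousLinearMap.inCoordinates]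
  -- A bilinear form is a section of an iterated hom bundle, so the inner bundle of linear forms has
  -- to be trivialized at `y` as well.
  have hy' : y ∈ (trivializationAt (E →L[ℝ] ℝ)
      (fun x : M ↦ TangentSpace 𝓘(ℝ, E) x →L[ℝ] ℝ) x).baseSet := by
    simpa using hy
  rw [Trivialization.coe_linearMapAt_of_mem _ hy']
  simp [hom_trivializationAt_apply, ContinuousLinearMap.inCoordinates]

/-- The metric coefficients of the preferred chart at `x₀`, as functions on the model space. -/
def chartMetric (x₀ : M) (e : E) : E →L[ℝ] E →L[ℝ] ℝ :=
  metricCoeff E x₀ ((extChartAt 𝓘(ℝ, E) x₀).symm e)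

theorem chartMetric_symm (x₀ : M) (e a b : E) : chartMetric x₀ e a b = chartMetric x₀ e b a :=
  metricCoeff_symm x₀ _ a b

theorem chartMetric_self (x : M) :
    chartMetric x (extChartAt 𝓘(ℝ, E) x x) = metricCoeff E x x := by
  rw [chartMetric, extChartAt_to_inv]

theorem differentiableAt_chartMetric (x : M) :
    DifferentiableAt ℝ (chartMetric x) (extChartAt 𝓘(ℝ, E) x x) :=
  differentiableAt_comp_extChartAt_symm (mdifferentiableAt_metricCoeff x)

theorem metricCoeffDeriv_eq (x : M) :
    metricCoeffDeriv E x = fderiv ℝ (chartMetric x) (extChartAt 𝓘(ℝ, E) x x) := by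
  ext1 v
  exact mvfderiv_apply_eq_fderiv (mdifferentiableAt_metricCoeff x) v

theorem inner_christoffel (x : M) (v w u : TangentSpace 𝓘(ℝ, E) x) :
    inner ℝ (christoffel x v w) u = christoffelFirst x v w u := by
  rw [christoffel, InnerProductSpace.toDual_symm_apply]

theorem christoffelFirst_apply (x : M) (v w u : TangentSpace 𝓘(ℝ, E) x) :
    christoffelFirst x v w u = (1 / 2 : ℝ) * (metricCoeffDeriv E x v w u
      + metricCoeffDeriv E x w v u - metricCoeffDeriv E x u v w) := rfl

variable (E) in
/-- The Christoffel symbol at `x` as a function on the model space. -/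
def chartChristoffel (x : M) (v w : E) : E := christoffel (E := E) x v w

/-- The bridge from the manifold to the model: the Christoffel symbol defined by Riesz duality
satisfies the coordinate Koszul identity. -/
theorem isChristoffelAt_chartChristoffel (x : M) :
    IsChristoffelAt (chartMetric x) (extChartAt 𝓘(ℝ, E) x x) (chartChristoffel E x) where
  symm v w := by
    refine congrArg (InnerProductSpace.toDual ℝ (TangentSpace 𝓘(ℝ, E) x)).symm ?_
    refine ContinuousLinearMap.ext fun u ↦ ?_
    refine (christoffelFirst_apply x v w u).trans
      (Eq.trans ?_ (christoffelFirst_apply x w v u).symm)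
    have h : ∀ u : E, metricCoeffDeriv E x u v w = metricCoeffDeriv E x u w v := by
      intro u
      rw [metricCoeffDeriv_eq]
      exact fderiv_bilin_symm (differentiableAt_chartMetric x) (chartMetric_symm x) u v w
    have hu : ∀ a b c d : ℝ, c = d → (1 / 2 : ℝ) * (a + b - c) = 1 / 2 * (b + a - d) := by
      intro a b c d hcd
      rw [hcd]
      ring
    exact hu _ _ _ _ (h u)
  koszul v w u := by
    rw [chartMetric_self, chartChristoffel]
    have h1 := (metricCoeff_self x (christoffel (E := E) x v w) u).trans
      ((inner_christoffel x v w u).trans (christoffelFirst_apply x v w u))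
    rw [metricCoeffDeriv_eq] at h1
    refine (congrArg (fun t ↦ 2 * t) h1).trans ?_
    ring

end Ambient

/-! ### Endomorphism fields in coordinates. -/

section Endomorphism

variable {E : Type*} [NormedAddCommGroup E] [NormedSpace ℝ E] [FiniteDimensional ℝ E]
  {M : Type*} [TopologicalSpace M] [ChartedSpace E M] [IsManifold 𝓘(ℝ, E) ∞ M]

/-- The matrix of an endomorphism field in the coordinate frame of the preferred chart at `x₀`. -/
def endoCoeff (J : Π x : M, TangentSpace 𝓘(ℝ, E) x →L[ℝ] TangentSpace 𝓘(ℝ, E) x) (x₀ y : M) :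
    E →L[ℝ] E :=
  ((trivializationAt E (TangentSpace 𝓘(ℝ, E) : M → Type _) x₀).continuousLinearMapAt ℝ y).comp
    ((J y).comp ((trivializationAt E (TangentSpace 𝓘(ℝ, E) : M → Type _) x₀).symmL ℝ y))

/-- `endoCoeff` as a function on the model space. -/
def chartEndo (J : Π x : M, TangentSpace 𝓘(ℝ, E) x →L[ℝ] TangentSpace 𝓘(ℝ, E) x) (x₀ : M)
    (e : E) : E →L[ℝ] E :=
  endoCoeff J x₀ ((extChartAt 𝓘(ℝ, E) x₀).symm e)

variable {J : Π x : M, TangentSpace 𝓘(ℝ, E) x →L[ℝ] TangentSpace 𝓘(ℝ, E) x}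

theorem endoCoeff_self (x : M) (a : TangentSpace 𝓘(ℝ, E) x) : endoCoeff J x x a = J x a :=
  (continuousLinearMapAt_trivializationAt_self (E := E) x _).trans
    (congrArg (J x) (symmL_trivializationAt_self (E := E) x a))

theorem chartEndo_self (x : M) :
    chartEndo J x (extChartAt 𝓘(ℝ, E) x x) = endoCoeff J x x := by
  rw [chartEndo, extChartAt_to_inv]

theorem mdifferentiableAt_endoCoeff
    (hJ : ContMDiff 𝓘(ℝ, E) (𝓘(ℝ, E).prod 𝓘(ℝ, E →L[ℝ] E)) ∞
      (fun x : M ↦ (TotalSpace.mk' (E →L[ℝ] E) x (J x) :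
        TotalSpace (E →L[ℝ] E)
          (fun x : M ↦ TangentSpace 𝓘(ℝ, E) x →L[ℝ] TangentSpace 𝓘(ℝ, E) x)))) (x : M) :
    MDifferentiableAt 𝓘(ℝ, E) 𝓘(ℝ, E →L[ℝ] E) (endoCoeff J x) x :=
  ((contMDiffAt_section x).1 (hJ x)).mdifferentiableAt (by simp)

end Endomorphism

/-! ### Maps between manifolds read in charts. -/

section ChartMap

variable {E : Type*} [NormedAddCommGroup E] [NormedSpace ℝ E]
  {M : Type*} [TopologicalSpace M] [ChartedSpace E M]
  {E' H' N : Type*} [NormedAddCommGroup E'] [NormedSpace ℝ E'] [TopologicalSpace H']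
  (I' : ModelWithCorners ℝ E' H') [I'.Boundaryless] [TopologicalSpace N] [ChartedSpace H' N]

variable (E) in
/-- A map `φ` read in the preferred charts at `x` and `φ x`. -/
def chartMap (φ : N → M) (x : N) (s : E') : E :=
  extChartAt 𝓘(ℝ, E) (φ x) (φ ((extChartAt I' x).symm s))

variable {I'}

theorem chartMap_self (φ : N → M) (x : N) :
    chartMap E I' φ x (extChartAt I' x x) = extChartAt 𝓘(ℝ, E) (φ x) (φ x) := by
  rw [chartMap, extChartAt_to_inv]

theorem differentiableAt_chartMap {φ : N → M} {x : N} (hφ : MDifferentiableAt I' 𝓘(ℝ, E) φ x) :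
    DifferentiableAt ℝ (chartMap E I' φ x) (extChartAt I' x x) := by
  have h := hφ.differentiableWithinAt_writtenInExtChartAt
  rwa [I'.range_eq_univ, differentiableWithinAt_univ] at h

theorem mfderiv_apply_eq_fderiv {φ : N → M} {x : N} (hφ : MDifferentiableAt I' 𝓘(ℝ, E) φ x)
    (z : TangentSpace I' x) :
    @Eq E (mfderiv I' 𝓘(ℝ, E) φ x z)
      (fderiv ℝ (chartMap E I' φ x) (extChartAt I' x x) z) := by
  have h : fderivWithin ℝ (chartMap E I' φ x) (Set.range I') (extChartAt I' x x) =
      fderiv ℝ (chartMap E I' φ x) (extChartAt I' x x) := by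
    rw [I'.range_eq_univ, fderivWithin_univ]
  exact (DFunLike.congr_fun hφ.mfderiv z).trans (DFunLike.congr_fun h z)

theorem eventually_mem_chart_source {φ : N → M} {x : N} (hφ : ContinuousAt φ x) :
    ∀ᶠ s in 𝓝 (extChartAt I' x x),
      φ ((extChartAt I' x).symm s) ∈ (chartAt E (φ x)).source := by
  have h1 : ContinuousAt (extChartAt I' x).symm (extChartAt I' x x) :=
    continuousAt_extChartAt_symm x
  have h2 : ContinuousAt (fun s ↦ φ ((extChartAt I' x).symm s)) (extChartAt I' x x) :=
    ContinuousAt.comp (g := φ) (by rwa [extChartAt_to_inv]) h1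
  refine h2.eventually_mem ((chartAt E (φ x)).open_source.mem_nhds ?_)
  rw [extChartAt_to_inv]
  exact mem_chart_source E (φ x)

end ChartMap

/-! ### Covariant derivatives along a map, and parallel endomorphisms. -/

section Along

variable {E : Type*} [NormedAddCommGroup E] [NormedSpace ℝ E] [FiniteDimensional ℝ E]
  {M : Type*} [TopologicalSpace M] [ChartedSpace E M] [IsManifold 𝓘(ℝ, E) ∞ M]
  {E' H' N : Type*} [NormedAddCommGroup E'] [NormedSpace ℝ E'] [TopologicalSpace H']
  {I' : ModelWithCorners ℝ E' H'} [I'.Boundaryless] [TopologicalSpace N] [ChartedSpace H' N]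

theorem trivializationAt_snd {x₀ y : M} (hy : y ∈ (chartAt E x₀).source)
    (v : TangentSpace 𝓘(ℝ, E) y) :
    (trivializationAt E (TangentSpace 𝓘(ℝ, E) : M → Type _) x₀ (TotalSpace.mk' E y v)).2 =
      (trivializationAt E (TangentSpace 𝓘(ℝ, E) : M → Type _) x₀).continuousLinearMapAt ℝ y v := by
  rw [Trivialization.continuousLinearMapAt_apply, Trivialization.coe_linearMapAt_of_mem]
  simpa using hy

/-- The components of a vector field along `φ`, in the preferred chart at `φ x`. -/
def alongCoord (φ : N → M) (V : Π y : N, TangentSpace 𝓘(ℝ, E) (φ y)) (x y : N) : E :=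
  (trivializationAt E (TangentSpace 𝓘(ℝ, E) : M → Type _) (φ x) (TotalSpace.mk' E (φ y) (V y))).2

theorem alongCoord_self (φ : N → M) (V : Π y : N, TangentSpace 𝓘(ℝ, E) (φ y)) (x : N) :
    alongCoord φ V x x = V x :=
  (trivializationAt_snd (mem_chart_source E (φ x)) (V x)).trans
    (continuousLinearMapAt_trivializationAt_self (φ x) (V x))

theorem endoCoeff_apply_continuousLinearMapAt
    (J : Π x : M, TangentSpace 𝓘(ℝ, E) x →L[ℝ] TangentSpace 𝓘(ℝ, E) x)
    {x₀ y : M} (hy : y ∈ (chartAt E x₀).source) (v : TangentSpace 𝓘(ℝ, E) y) :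
    endoCoeff J x₀ y ((trivializationAt E (TangentSpace 𝓘(ℝ, E) : M → Type _)
        x₀).continuousLinearMapAt ℝ y v) =
      (trivializationAt E (TangentSpace 𝓘(ℝ, E) : M → Type _) x₀).continuousLinearMapAt ℝ y
        (J y v) := by
  rw [endoCoeff, ContinuousLinearMap.comp_apply, ContinuousLinearMap.comp_apply,
    Trivialization.symmL_continuousLinearMapAt _ (by simpa using hy)]

theorem alongCoord_map (J : Π x : M, TangentSpace 𝓘(ℝ, E) x →L[ℝ] TangentSpace 𝓘(ℝ, E) x)
    (φ : N → M) (V : Π y : N, TangentSpace 𝓘(ℝ, E) (φ y)) {x y : N}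
    (hy : φ y ∈ (chartAt E (φ x)).source) :
    alongCoord φ (fun y ↦ J (φ y) (V y)) x y =
      endoCoeff J (φ x) (φ y) (alongCoord φ V x y) := by
  rw [alongCoord, alongCoord, trivializationAt_snd hy, trivializationAt_snd hy,
    endoCoeff_apply_continuousLinearMapAt J hy]

variable [RiemannianBundle (fun x : M ↦ TangentSpace 𝓘(ℝ, E) x)]

theorem covAlong_eq {φ : N → M} {V : Π y : N, TangentSpace 𝓘(ℝ, E) (φ y)} {x : N}
    (hV : MDifferentiableAt I' 𝓘(ℝ, E) (alongCoord φ V x) x) (z : TangentSpace I' x) :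
    @Eq E (covAlong I' φ V x z)
      (fderiv ℝ (alongCoord φ V x ∘ (extChartAt I' x).symm) (extChartAt I' x x) z
        + chartChristoffel E (φ x) (mfderiv I' 𝓘(ℝ, E) φ x z) (V x)) :=
  congrArg (fun a : E ↦ a + chartChristoffel E (φ x) (mfderiv I' 𝓘(ℝ, E) φ x z) (V x))
    (mvfderiv_apply_eq_fderiv hV z)

/-- The equality is stated in `E`, which underlies every tangent space, so that the right side can
be a pure model-space expression. -/
theorem covAlong_eq_chart {φ : N → M} {V : Π y : N, TangentSpace 𝓘(ℝ, E) (φ y)} {x : N}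
    (hφ : MDifferentiableAt I' 𝓘(ℝ, E) φ x)
    (hV : MDifferentiableAt I' 𝓘(ℝ, E) (alongCoord φ V x) x) (ζ : E') :
    @Eq E (covAlong I' φ V x ζ)
      (fderiv ℝ (alongCoord φ V x ∘ (extChartAt I' x).symm) (extChartAt I' x x) ζ
        + chartChristoffel E (φ x) (fderiv ℝ (chartMap E I' φ x) (extChartAt I' x x) ζ)
          (alongCoord φ V x x)) :=
  (covAlong_eq hV ζ).trans (congrArg₂ (fun a b : E ↦
    fderiv ℝ (alongCoord φ V x ∘ (extChartAt I' x).symm) (extChartAt I' x x) ζ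
      + chartChristoffel E (φ x) a b) (mfderiv_apply_eq_fderiv hφ ζ) (alongCoord_self φ V x).symm)

/-- The derivative of a parallel endomorphism field, in coordinates. -/
theorem IsLocallyMetallic.fderiv_chartEndo
    {p q : ℕ} {J : Π x : M, TangentSpace 𝓘(ℝ, E) x →L[ℝ] TangentSpace 𝓘(ℝ, E) x}
    (hJ : IsLocallyMetallic p q J) (x : M) (v a : E) :
    fderiv ℝ (chartEndo J x) (extChartAt 𝓘(ℝ, E) x x) v a +
        chartChristoffel E x v (endoCoeff J x x a) =
      endoCoeff J x x (chartChristoffel E x v a) := by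
  -- Test parallelism on the coordinate field with constant components `a`: there `∇_v Y = Γ(v, a)`,
  -- while `∇_v(JY)` is the derivative of the matrix of `J` plus `Γ(v, Ja)`.
  let Y : Π y : M, TangentSpace 𝓘(ℝ, E) y := fun y ↦
    (trivializationAt E (TangentSpace 𝓘(ℝ, E) : M → Type _) x).symmL ℝ y a
  have hsrc := eventually_mem_chart_source (E := E) (I' := 𝓘(ℝ, E)) (φ := fun y : M ↦ y)
    (continuousAt_id (x := x))
  have hsrc' : ∀ᶠ y in 𝓝 x, y ∈ (chartAt E x).source :=
    (chartAt E x).open_source.mem_nhds (mem_chart_source E x)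
  have hYx : Y x = a := symmL_trivializationAt_self x a
  have hY1 : ∀ y ∈ (chartAt E x).source, alongCoord (fun y : M ↦ y) Y x y = a := fun y hy ↦
    (trivializationAt_snd hy _).trans
      (Trivialization.continuousLinearMapAt_symmL _ (by simpa using hy) a)
  have hJY1 : ∀ y ∈ (chartAt E x).source,
      alongCoord (fun y : M ↦ y) (fun y ↦ J y (Y y)) x y = endoCoeff J x y a := fun y hy ↦ by
    rw [alongCoord_map J (fun y : M ↦ y) Y hy, hY1 y hy]
  have hYd : MDifferentiableAt 𝓘(ℝ, E) 𝓘(ℝ, E) (alongCoord (fun y : M ↦ y) Y x) x :=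
    (mdifferentiableAt_const (c := a)).congr_of_eventuallyEq (hsrc'.mono hY1)
  have hY : MDifferentiableAt 𝓘(ℝ, E) (𝓘(ℝ, E).prod 𝓘(ℝ, E))
      (fun y : M ↦ (TotalSpace.mk' E y (Y y) : TangentBundle 𝓘(ℝ, E) M)) x :=
    (mdifferentiableAt_totalSpace 𝓘(ℝ, E) _).2 ⟨mdifferentiableAt_id, hYd⟩
  have hE : MDifferentiableAt 𝓘(ℝ, E) 𝓘(ℝ, E) (fun y ↦ endoCoeff J x y a) x :=
    (mdifferentiableAt_endoCoeff hJ.smooth x).clm_apply mdifferentiableAt_const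
  have hEd : DifferentiableAt ℝ (chartEndo J x) (extChartAt 𝓘(ℝ, E) x x) :=
    differentiableAt_comp_extChartAt_symm (mdifferentiableAt_endoCoeff hJ.smooth x)
  have key := hJ.parallel Y x v hY
  have e1 := covAlong_eq (I' := 𝓘(ℝ, E)) hYd v
  have e2 := covAlong_eq (I' := 𝓘(ℝ, E)) (hE.congr_of_eventuallyEq (hsrc'.mono hJY1)) v
  have e3 : fderiv ℝ (alongCoord (fun y : M ↦ y) Y x ∘ (extChartAt 𝓘(ℝ, E) x).symm)
      (extChartAt 𝓘(ℝ, E) x x) = 0 := by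
    have h : alongCoord (fun y : M ↦ y) Y x ∘ (extChartAt 𝓘(ℝ, E) x).symm
        =ᶠ[𝓝 (extChartAt 𝓘(ℝ, E) x x)] fun _ ↦ a := hsrc.mono fun s hs ↦ hY1 _ hs
    rw [h.fderiv_eq, fderiv_fun_const, Pi.zero_apply]
  have e4 : fderiv ℝ (alongCoord (fun y : M ↦ y) (fun y ↦ J y (Y y)) x ∘
      (extChartAt 𝓘(ℝ, E) x).symm) (extChartAt 𝓘(ℝ, E) x x) v =
      fderiv ℝ (chartEndo J x) (extChartAt 𝓘(ℝ, E) x x) v a := by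
    have h : alongCoord (fun y : M ↦ y) (fun y ↦ J y (Y y)) x ∘ (extChartAt 𝓘(ℝ, E) x).symm
        =ᶠ[𝓝 (extChartAt 𝓘(ℝ, E) x x)] fun s ↦ chartEndo J x s a :=
      hsrc.mono fun s hs ↦ hJY1 _ hs
    rw [h.fderiv_eq, (hEd.hasFDerivAt.clm_apply (hasFDerivAt_const a _)).fderiv]
    simp
  have e5 : @Eq E (mfderiv 𝓘(ℝ, E) 𝓘(ℝ, E) (fun y : M ↦ y) x v) v :=
    DFunLike.congr_fun (mfderiv_id (I := 𝓘(ℝ, E)) (x := x)) v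
  have e1' : @Eq E (leviCivita Y x v) (chartChristoffel E x v a) := by
    refine e1.trans ?_
    rw [e3, e5, hYx]
    exact zero_add _
  have e2' : @Eq E (leviCivita (fun y ↦ J y (Y y)) x v)
      (fderiv ℝ (chartEndo J x) (extChartAt 𝓘(ℝ, E) x x) v a
        + chartChristoffel E x v (endoCoeff J x x a)) := by
    refine e2.trans ?_
    rw [e4, e5, hYx]
    exact congrArg (fun b : E ↦ fderiv ℝ (chartEndo J x) (extChartAt 𝓘(ℝ, E) x x) v a
      + chartChristoffel E x v b) (endoCoeff_self (E := E) x a).symm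
  rw [← e2']
  refine key.trans ?_
  exact (endoCoeff_self (E := E) x _).symm.trans (congrArg (endoCoeff J x x) e1')

/-- A parallel endomorphism field commutes with covariant differentiation along a map. -/
theorem IsLocallyMetallic.covAlong_map
    {p q : ℕ} {J : Π x : M, TangentSpace 𝓘(ℝ, E) x →L[ℝ] TangentSpace 𝓘(ℝ, E) x}
    (hJ : IsLocallyMetallic p q J) {φ : N → M} {x : N} (hφ : MDifferentiableAt I' 𝓘(ℝ, E) φ x)
    {V : Π y : N, TangentSpace 𝓘(ℝ, E) (φ y)}
    (hV : MDifferentiableAt I' 𝓘(ℝ, E) (alongCoord φ V x) x) (z : E') :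
    covAlong I' φ (fun y ↦ J (φ y) (V y)) x z = J (φ x) (covAlong I' φ V x z) := by
  have hsrc := eventually_mem_chart_source (E := E) (I' := I') hφ.continuousAt
  have hsrc' : ∀ᶠ y in 𝓝 x, φ y ∈ (chartAt E (φ x)).source :=
    hφ.continuousAt.eventually_mem ((chartAt E (φ x)).open_source.mem_nhds (mem_chart_source E _))
  have hEd : DifferentiableAt ℝ (chartEndo J (φ x)) (chartMap E I' φ x (extChartAt I' x x)) := by
    rw [chartMap_self]
    exact differentiableAt_comp_extChartAt_symm (mdifferentiableAt_endoCoeff hJ.smooth (φ x))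
  have hψ := differentiableAt_chartMap hφ
  have hVd := differentiableAt_comp_extChartAt_symm hV
  have hJV1 : ∀ y, φ y ∈ (chartAt E (φ x)).source →
      alongCoord φ (fun y ↦ J (φ y) (V y)) x y =
        endoCoeff J (φ x) (φ y) (alongCoord φ V x y) := fun y hy ↦ alongCoord_map J φ V hy
  have hE : MDifferentiableAt I' 𝓘(ℝ, E)
      (fun y ↦ endoCoeff J (φ x) (φ y) (alongCoord φ V x y)) x :=
    (MDifferentiableAt.comp (g := endoCoeff J (φ x)) x
      (mdifferentiableAt_endoCoeff hJ.smooth (φ x)) hφ).clm_apply hV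
  have e1 := covAlong_eq_chart hφ hV z
  have e2 := covAlong_eq_chart hφ (hE.congr_of_eventuallyEq (hsrc'.mono hJV1)) z
  have e4 : ∀ ζ : E', fderiv ℝ (alongCoord φ (fun y ↦ J (φ y) (V y)) x ∘ (extChartAt I' x).symm)
      (extChartAt I' x x) ζ =
      fderiv ℝ (chartEndo J (φ x)) (extChartAt 𝓘(ℝ, E) (φ x) (φ x))
        (fderiv ℝ (chartMap E I' φ x) (extChartAt I' x x) ζ) (alongCoord φ V x x)
      + endoCoeff J (φ x) (φ x)
        (fderiv ℝ (alongCoord φ V x ∘ (extChartAt I' x).symm) (extChartAt I' x x) ζ) := by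
    intro ζ
    have h : alongCoord φ (fun y ↦ J (φ y) (V y)) x ∘ (extChartAt I' x).symm
        =ᶠ[𝓝 (extChartAt I' x x)] fun s ↦ chartEndo J (φ x) (chartMap E I' φ x s)
          ((alongCoord φ V x ∘ (extChartAt I' x).symm) s) := by
      filter_upwards [hsrc] with s hs
      refine (hJV1 _ hs).trans ?_
      rw [chartEndo, chartMap, (extChartAt 𝓘(ℝ, E) (φ x)).left_inv (by simpa using hs)]
      rfl
    have hd := (HasFDerivAt.comp (g := chartEndo J (φ x)) _ hEd.hasFDerivAt
      hψ.hasFDerivAt).clm_apply hVd.hasFDerivAt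
    rw [h.fderiv_eq, HasFDerivAt.fderiv (f := fun s ↦ chartEndo J (φ x) (chartMap E I' φ x s)
          ((alongCoord φ V x ∘ (extChartAt I' x).symm) s)) hd]
    simp only [_root_.add_apply, ContinuousLinearMap.comp_apply, ContinuousLinearMap.flip_apply,
      Function.comp_apply, chartMap_self, chartEndo_self, extChartAt_to_inv]
    rw [add_comm]
  -- The product rule leaves the derivative of the matrix of `J` plus `Γ(·, JV)`; parallelism
  -- replaces this sum by `J Γ(·, V)`.
  have e6 := hJ.fderiv_chartEndo (φ x) (fderiv ℝ (chartMap E I' φ x) (extChartAt I' x x) z)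
    (alongCoord φ V x x)
  have e7 : alongCoord φ (fun y ↦ J (φ y) (V y)) x x =
      endoCoeff J (φ x) (φ x) (alongCoord φ V x x) := hJV1 x (mem_chart_source E (φ x))
  rw [e4, e7] at e2
  refine Eq.trans e2 (Eq.trans ?_ (endoCoeff_self (E := E) (φ x) _))
  refine Eq.trans ?_ (congrArg (endoCoeff J (φ x) (φ x)) e1.symm)
  rw [map_add, ← e6]
  abel

end Along

/-! ### Trivializations of the tangent bundle as differentials of charts. -/

section TangentCharts

variable {E : Type*} [NormedAddCommGroup E] [NormedSpace ℝ E]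
  {M : Type*} [TopologicalSpace M] [ChartedSpace E M] [IsManifold 𝓘(ℝ, E) ∞ M]

theorem hasMFDerivAt_extChartAt_clm {x₀ y : M} (hy : y ∈ (chartAt E x₀).source) :
    HasMFDerivAt 𝓘(ℝ, E) 𝓘(ℝ, E) (extChartAt 𝓘(ℝ, E) x₀) y
      ((trivializationAt E (TangentSpace 𝓘(ℝ, E) : M → Type _) x₀).continuousLinearMapAt ℝ y) := by
  rw [TangentBundle.continuousLinearMapAt_trivializationAt hy]
  exact (mdifferentiableAt_extChartAt hy).hasMFDerivAt

theorem hasMFDerivAt_extChartAt_symm {x₀ : M} {e : E} (he : e ∈ (extChartAt 𝓘(ℝ, E) x₀).target) :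
    HasMFDerivAt 𝓘(ℝ, E) 𝓘(ℝ, E) (extChartAt 𝓘(ℝ, E) x₀).symm e
      ((trivializationAt E (TangentSpace 𝓘(ℝ, E) : M → Type _) x₀).symmL ℝ
        ((extChartAt 𝓘(ℝ, E) x₀).symm e)) := by
  have hy : (extChartAt 𝓘(ℝ, E) x₀).symm e ∈ (chartAt E x₀).source := by
    simpa using (extChartAt 𝓘(ℝ, E) x₀).map_target he
  rw [TangentBundle.symmL_trivializationAt hy, (extChartAt 𝓘(ℝ, E) x₀).right_inv he]
  have h := (mdifferentiableWithinAt_extChartAt_symm he).hasMFDerivWithinAt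
  rw [ModelWithCorners.range_eq_univ] at h ⊢
  exact hasMFDerivWithinAt_univ.1 h

end TangentCharts

/-! ### Charts, lifts and slices of a product manifold. -/

section Product

variable {E₁ : Type*} [NormedAddCommGroup E₁] [NormedSpace ℝ E₁]
  {E₂ : Type*} [NormedAddCommGroup E₂] [NormedSpace ℝ E₂]
  {M₁ : Type*} [TopologicalSpace M₁] [ChartedSpace E₁ M₁] [IsManifold 𝓘(ℝ, E₁) ∞ M₁]
  {M₂ : Type*} [TopologicalSpace M₂] [ChartedSpace E₂ M₂] [IsManifold 𝓘(ℝ, E₂) ∞ M₂]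
  {E : Type*} [NormedAddCommGroup E] [NormedSpace ℝ E]
  {M : Type*} [TopologicalSpace M] [ChartedSpace E M] [IsManifold 𝓘(ℝ, E) ∞ M]

/-- The tangent vector to `M₁ × M₂` with components `a` and `b`. -/
def tangentPair (y : M₁ × M₂) (a : TangentSpace 𝓘(ℝ, E₁) y.1) (b : TangentSpace 𝓘(ℝ, E₂) y.2) :
    TangentSpace (𝓘(ℝ, E₁).prod 𝓘(ℝ, E₂)) y :=
  ((a, b) : E₁ × E₂)

theorem extChartAt_prod_apply (x y : M₁ × M₂) :
    extChartAt (𝓘(ℝ, E₁).prod 𝓘(ℝ, E₂)) x y =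
      (extChartAt 𝓘(ℝ, E₁) x.1 y.1, extChartAt 𝓘(ℝ, E₂) x.2 y.2) := rfl

theorem mem_extChartAt_prod_target {x : M₁ × M₂} {s : E₁ × E₂} :
    s ∈ (extChartAt (𝓘(ℝ, E₁).prod 𝓘(ℝ, E₂)) x).target ↔
      s.1 ∈ (extChartAt 𝓘(ℝ, E₁) x.1).target ∧ s.2 ∈ (extChartAt 𝓘(ℝ, E₂) x.2).target := by
  rw [extChartAt_prod]
  exact Iff.rfl

/-- The derivative of `φ` in charts, in terms of the trivializations of the tangent bundles. -/
theorem fderiv_chartMap_prod {φ : M₁ × M₂ → M}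
    (hφ : MDifferentiable (𝓘(ℝ, E₁).prod 𝓘(ℝ, E₂)) 𝓘(ℝ, E) φ) {x : M₁ × M₂} {s : E₁ × E₂}
    (hs : s ∈ (extChartAt (𝓘(ℝ, E₁).prod 𝓘(ℝ, E₂)) x).target)
    {y : M₁ × M₂} (hy : y = (extChartAt (𝓘(ℝ, E₁).prod 𝓘(ℝ, E₂)) x).symm s)
    (hφy : φ y ∈ (chartAt E (φ x)).source) (u : E₁ × E₂) :
    fderiv ℝ (chartMap E (𝓘(ℝ, E₁).prod 𝓘(ℝ, E₂)) φ x) s u =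
      (trivializationAt E (TangentSpace 𝓘(ℝ, E) : M → Type _) (φ x)).continuousLinearMapAt ℝ (φ y)
        (mfderiv (𝓘(ℝ, E₁).prod 𝓘(ℝ, E₂)) 𝓘(ℝ, E) φ y (tangentPair y
          ((trivializationAt E₁ (TangentSpace 𝓘(ℝ, E₁) : M₁ → Type _) x.1).symmL ℝ y.1 u.1)
          ((trivializationAt E₂ (TangentSpace 𝓘(ℝ, E₂) : M₂ → Type _) x.2).symmL ℝ y.2 u.2))) := by
  subst hy
  obtain ⟨hs₁, hs₂⟩ := mem_extChartAt_prod_target.1 hs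
  have hf : HasMFDerivAt 𝓘(ℝ, E₁ × E₂) 𝓘(ℝ, E₁) (Prod.fst : E₁ × E₂ → E₁) s
    (ContinuousLinearMap.fst ℝ E₁ E₂) := (hasFDerivAt_fst (𝕜 := ℝ) (p := s)).hasMFDerivAt
  have hg : HasMFDerivAt 𝓘(ℝ, E₁ × E₂) 𝓘(ℝ, E₂) (Prod.snd : E₁ × E₂ → E₂) s
    (ContinuousLinearMap.snd ℝ E₁ E₂) := (hasFDerivAt_snd (𝕜 := ℝ) (p := s)).hasMFDerivAt
  have h1 := (hasMFDerivAt_extChartAt_symm hs₁).comp s hf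
  have h2 := (hasMFDerivAt_extChartAt_symm hs₂).comp s hg
  have h3 := h1.prodMk h2
  have h4 := HasMFDerivAt.comp s ((hφ _).hasMFDerivAt) h3
  have h5 := HasMFDerivAt.comp s (hasMFDerivAt_extChartAt_clm hφy) h4
  -- Repackage the composite differential as one linear map between model spaces, so that the
  -- manifold derivative becomes a Fréchet derivative.
  obtain ⟨D, hD, hDu⟩ : ∃ D : E₁ × E₂ →L[ℝ] E,
      HasMFDerivAt 𝓘(ℝ, E₁ × E₂) 𝓘(ℝ, E) (chartMap E (𝓘(ℝ, E₁).prod 𝓘(ℝ, E₂)) φ x) s D ∧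
      D u = _ := ⟨_, h5, rfl⟩
  have hD' : HasFDerivAt (chartMap E (𝓘(ℝ, E₁).prod 𝓘(ℝ, E₂)) φ x) D s :=
    hasMFDerivAt_iff_hasFDerivAt.1 hD
  exact (DFunLike.congr_fun hD'.fderiv u).trans hDu

theorem contDiffAt_chartMap {φ : M₁ × M₂ → M} {x : M₁ × M₂}
    (hφ : ContMDiffAt (𝓘(ℝ, E₁).prod 𝓘(ℝ, E₂)) 𝓘(ℝ, E) ∞ φ x) :
    ContDiffAt ℝ ∞ (chartMap E (𝓘(ℝ, E₁).prod 𝓘(ℝ, E₂)) φ x)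
      (extChartAt (𝓘(ℝ, E₁).prod 𝓘(ℝ, E₂)) x x) := by
  have h := (contMDiffAt_iff.1 hφ).2
  rwa [ModelWithCorners.range_eq_univ, contDiffWithinAt_univ] at h

theorem eventually_chartMap_prod {φ : M₁ × M₂ → M} {x : M₁ × M₂} (hφ : ContinuousAt φ x) :
    ∀ᶠ s in 𝓝 (extChartAt (𝓘(ℝ, E₁).prod 𝓘(ℝ, E₂)) x x),
      s ∈ (extChartAt (𝓘(ℝ, E₁).prod 𝓘(ℝ, E₂)) x).target ∧
      φ ((extChartAt (𝓘(ℝ, E₁).prod 𝓘(ℝ, E₂)) x).symm s) ∈ (chartAt E (φ x)).source :=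
  Filter.Eventually.and (extChartAt_target_mem_nhds x) (eventually_mem_chart_source hφ)

theorem mfderiv_fst_tangentPair (y : M₁ × M₂) (a : TangentSpace 𝓘(ℝ, E₁) y.1)
    (b : TangentSpace 𝓘(ℝ, E₂) y.2) :
    mfderiv (𝓘(ℝ, E₁).prod 𝓘(ℝ, E₂)) 𝓘(ℝ, E₁) Prod.fst y (tangentPair y a b) = a :=
  DFunLike.congr_fun (mfderiv_fst (I := 𝓘(ℝ, E₁)) (I' := 𝓘(ℝ, E₂)) (x := y)) (tangentPair y a b)

theorem mfderiv_snd_tangentPair (y : M₁ × M₂) (a : TangentSpace 𝓘(ℝ, E₁) y.1)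
    (b : TangentSpace 𝓘(ℝ, E₂) y.2) :
    mfderiv (𝓘(ℝ, E₁).prod 𝓘(ℝ, E₂)) 𝓘(ℝ, E₂) Prod.snd y (tangentPair y a b) = b :=
  DFunLike.congr_fun (mfderiv_snd (I := 𝓘(ℝ, E₁)) (I' := 𝓘(ℝ, E₂)) (x := y)) (tangentPair y a b)

theorem liftFst_eq (X : Π x : M₁, TangentSpace 𝓘(ℝ, E₁) x) (y : M₁ × M₂) :
    (liftFst X y : TangentSpace (𝓘(ℝ, E₁).prod 𝓘(ℝ, E₂)) y) = tangentPair y (X y.1) 0 :=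
  DFunLike.congr_fun (mfderiv_prod_left (I := 𝓘(ℝ, E₁)) (I' := 𝓘(ℝ, E₂)) (x₀ := y.1) (y₀ := y.2))
    (X y.1)

theorem liftSnd_eq (Z : Π x : M₂, TangentSpace 𝓘(ℝ, E₂) x) (y : M₁ × M₂) :
    (liftSnd Z y : TangentSpace (𝓘(ℝ, E₁).prod 𝓘(ℝ, E₂)) y) = tangentPair y 0 (Z y.2) :=
  DFunLike.congr_fun (mfderiv_prod_right (I := 𝓘(ℝ, E₁)) (I' := 𝓘(ℝ, E₂)) (x₀ := y.1) (y₀ := y.2))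
    (Z y.2)

theorem mfderiv_slice_fst {φ : M₁ × M₂ → M}
    (hφ : MDifferentiable (𝓘(ℝ, E₁).prod 𝓘(ℝ, E₂)) 𝓘(ℝ, E) φ) (x : M₁ × M₂)
    (a : TangentSpace 𝓘(ℝ, E₁) x.1) :
    mfderiv 𝓘(ℝ, E₁) 𝓘(ℝ, E) (fun y : M₁ ↦ φ (y, x.2)) x.1 a =
      mfderiv (𝓘(ℝ, E₁).prod 𝓘(ℝ, E₂)) 𝓘(ℝ, E) φ x (tangentPair x a 0) := by
  have h : MDifferentiableAt 𝓘(ℝ, E₁) (𝓘(ℝ, E₁).prod 𝓘(ℝ, E₂)) (fun y : M₁ ↦ (y, x.2)) x.1 :=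
    mdifferentiableAt_id.prodMk mdifferentiableAt_const
  exact (mfderiv_comp_apply (g := φ) x.1 (hφ _) h a).trans
    (congrArg (mfderiv (𝓘(ℝ, E₁).prod 𝓘(ℝ, E₂)) 𝓘(ℝ, E) φ x)
      (DFunLike.congr_fun (mfderiv_prod_left (I := 𝓘(ℝ, E₁)) (I' := 𝓘(ℝ, E₂))
        (x₀ := x.1) (y₀ := x.2)) a))

theorem mfderiv_slice_snd {φ : M₁ × M₂ → M}
    (hφ : MDifferentiable (𝓘(ℝ, E₁).prod 𝓘(ℝ, E₂)) 𝓘(ℝ, E) φ) (x : M₁ × M₂)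
    (b : TangentSpace 𝓘(ℝ, E₂) x.2) :
    mfderiv 𝓘(ℝ, E₂) 𝓘(ℝ, E) (fun y : M₂ ↦ φ (x.1, y)) x.2 b =
      mfderiv (𝓘(ℝ, E₁).prod 𝓘(ℝ, E₂)) 𝓘(ℝ, E) φ x (tangentPair x 0 b) := by
  have h : MDifferentiableAt 𝓘(ℝ, E₂) (𝓘(ℝ, E₁).prod 𝓘(ℝ, E₂)) (fun y : M₂ ↦ (x.1, y)) x.2 :=
    mdifferentiableAt_const.prodMk mdifferentiableAt_id
  exact (mfderiv_comp_apply (g := φ) x.2 (hφ _) h b).trans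
    (congrArg (mfderiv (𝓘(ℝ, E₁).prod 𝓘(ℝ, E₂)) 𝓘(ℝ, E) φ x)
      (DFunLike.congr_fun (mfderiv_prod_right (I := 𝓘(ℝ, E₁)) (I' := 𝓘(ℝ, E₂))
        (x₀ := x.1) (y₀ := x.2)) b))

end Product

/-! ### Inner products from metric coefficients. -/

section Metric

variable {E : Type*} [NormedAddCommGroup E] [NormedSpace ℝ E] [FiniteDimensional ℝ E]
  {M : Type*} [TopologicalSpace M] [ChartedSpace E M] [IsManifold 𝓘(ℝ, E) ∞ M]
  [RiemannianBundle (fun x : M ↦ TangentSpace 𝓘(ℝ, E) x)]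

theorem metricCoeff_continuousLinearMapAt {x₀ y : M} (hy : y ∈ (chartAt E x₀).source)
    (v w : TangentSpace 𝓘(ℝ, E) y) :
    metricCoeff E x₀ y
      ((trivializationAt E (TangentSpace 𝓘(ℝ, E) : M → Type _) x₀).continuousLinearMapAt ℝ y v)
      ((trivializationAt E (TangentSpace 𝓘(ℝ, E) : M → Type _) x₀).continuousLinearMapAt ℝ y w) =
      inner ℝ v w := by
  rw [metricCoeff_apply, Trivialization.symmL_continuousLinearMapAt _ (by simpa using hy),
    Trivialization.symmL_continuousLinearMapAt _ (by simpa using hy)]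

end Metric

/-! ### Lifted vector fields of the first factor, in coordinates. -/

section Model

theorem mdifferentiableAt_of_comp_extChartAt_symm
    {E' H' N : Type*} [NormedAddCommGroup E'] [NormedSpace ℝ E'] [TopologicalSpace H']
    {I' : ModelWithCorners ℝ E' H'} [I'.Boundaryless] [TopologicalSpace N] [ChartedSpace H' N]
    [IsManifold I' 1 N] {V : Type*} [NormedAddCommGroup V] [NormedSpace ℝ V] {g : N → V} {x : N}
    (hg : DifferentiableAt ℝ (g ∘ (extChartAt I' x).symm) (extChartAt I' x x)) :
    MDifferentiableAt I' 𝓘(ℝ, V) g x := by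
  have h := MDifferentiableAt.comp x hg.mdifferentiableAt
    (mdifferentiableAt_extChartAt (I := I') (mem_chart_source H' x))
  refine h.congr_of_eventuallyEq ?_
  filter_upwards [extChartAt_source_mem_nhds (I := I') x] with y hy
  simp only [Function.comp_apply, (extChartAt I' x).left_inv hy]

variable {E₁ : Type*} [NormedAddCommGroup E₁] [NormedSpace ℝ E₁]
  {E₂ : Type*} [NormedAddCommGroup E₂] [NormedSpace ℝ E₂]
  {E : Type*} [NormedAddCommGroup E] [NormedSpace ℝ E]

theorem hasFDerivAt_fderiv_fst {ψ : E₁ × E₂ → E} {s : E₁ × E₂} (hψ : ContDiffAt ℝ 2 ψ s)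
    {ξ : E₁ → E₁} (hξ : DifferentiableAt ℝ ξ s.1) :
    HasFDerivAt (fun r : E₁ × E₂ ↦ fderiv ℝ ψ r (ξ r.1, 0))
      ((fderiv ℝ ψ s).comp ((ContinuousLinearMap.inl ℝ E₁ E₂).comp
        ((fderiv ℝ ξ s.1).comp (ContinuousLinearMap.fst ℝ E₁ E₂)))
        + (fderiv ℝ (fderiv ℝ ψ) s).flip (ξ s.1, 0)) s := by
  have h : ContDiffAt ℝ 1 (fderiv ℝ ψ) s := hψ.fderiv_right (by norm_num)
  have p₁ : HasFDerivAt Prod.fst (ContinuousLinearMap.fst ℝ E₁ E₂) s := hasFDerivAt_fst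
  have h1 : HasFDerivAt (fun r : E₁ × E₂ ↦ ContinuousLinearMap.inl ℝ E₁ E₂ (ξ r.1)) _ s :=
    (ContinuousLinearMap.inl ℝ E₁ E₂).hasFDerivAt.comp s
      (HasFDerivAt.comp (g := ξ) s hξ.hasFDerivAt p₁)
  exact (h.differentiableAt (by norm_num)).hasFDerivAt.clm_apply h1

/-- The components `ξ` of a lifted field do not vary along the second factor, so they may be frozen
at their value; constant fields therefore suffice in the model computations. -/
theorem fderiv_fderiv_fst_apply_snd {ψ : E₁ × E₂ → E} {s : E₁ × E₂} (hψ : ContDiffAt ℝ 2 ψ s)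
    {ξ : E₁ → E₁} (hξ : DifferentiableAt ℝ ξ s.1) (z : E₂) :
    fderiv ℝ (fun r : E₁ × E₂ ↦ fderiv ℝ ψ r (ξ r.1, 0)) s (0, z) =
      fderiv ℝ (fun r ↦ fderiv ℝ ψ r (ξ s.1, 0)) s (0, z) := by
  rw [(hasFDerivAt_fderiv_fst hψ hξ).fderiv, fderiv_fderiv_apply hψ]
  simp
  exact map_zero (fderiv ℝ ψ s)

end Model

/-! ### The three inner products of `∇̄_Z X`. -/

section Warped

variable {E₁ : Type*} [NormedAddCommGroup E₁] [NormedSpace ℝ E₁] [FiniteDimensional ℝ E₁]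
  {E₂ : Type*} [NormedAddCommGroup E₂] [NormedSpace ℝ E₂] [FiniteDimensional ℝ E₂]
  {E : Type*} [NormedAddCommGroup E] [NormedSpace ℝ E] [FiniteDimensional ℝ E]
  {M₁ : Type*} [TopologicalSpace M₁] [ChartedSpace E₁ M₁] [IsManifold 𝓘(ℝ, E₁) ∞ M₁]
  [RiemannianBundle (fun x : M₁ ↦ TangentSpace 𝓘(ℝ, E₁) x)]
  [IsContMDiffRiemannianBundle 𝓘(ℝ, E₁) ∞ E₁ (fun x : M₁ ↦ TangentSpace 𝓘(ℝ, E₁) x)]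
  {M₂ : Type*} [TopologicalSpace M₂] [ChartedSpace E₂ M₂] [IsManifold 𝓘(ℝ, E₂) ∞ M₂]
  [RiemannianBundle (fun x : M₂ ↦ TangentSpace 𝓘(ℝ, E₂) x)]
  [IsContMDiffRiemannianBundle 𝓘(ℝ, E₂) ∞ E₂ (fun x : M₂ ↦ TangentSpace 𝓘(ℝ, E₂) x)]
  {M : Type*} [TopologicalSpace M] [ChartedSpace E M] [IsManifold 𝓘(ℝ, E) ∞ M]
  [RiemannianBundle (fun x : M ↦ TangentSpace 𝓘(ℝ, E) x)]
  [IsContMDiffRiemannianBundle 𝓘(ℝ, E) ∞ E (fun x : M ↦ TangentSpace 𝓘(ℝ, E) x)]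
  {J : Π x : M, TangentSpace 𝓘(ℝ, E) x →L[ℝ] TangentSpace 𝓘(ℝ, E) x}
  {f : M₁ → ℝ} {φ : M₁ × M₂ → M}

theorem IsWarpedSemiInvariant.mdifferentiable (hφ : IsWarpedSemiInvariant E₁ E₂ J f φ) :
    MDifferentiable (𝓘(ℝ, E₁).prod 𝓘(ℝ, E₂)) 𝓘(ℝ, E) φ :=
  hφ.smooth.mdifferentiable (by simp)

variable (E₁ E₂ E) in
/-- The image in the ambient tangent space of the vector with components `a` and `b`. -/
def push (φ : M₁ × M₂ → M) (y : M₁ × M₂) (a : TangentSpace 𝓘(ℝ, E₁) y.1)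
    (b : TangentSpace 𝓘(ℝ, E₂) y.2) : TangentSpace 𝓘(ℝ, E) (φ y) :=
  mfderiv (𝓘(ℝ, E₁).prod 𝓘(ℝ, E₂)) 𝓘(ℝ, E) φ y (tangentPair y a b)

theorem IsWarpedSemiInvariant.inner_push (hφ : IsWarpedSemiInvariant E₁ E₂ J f φ) (y : M₁ × M₂)
    (a a' : TangentSpace 𝓘(ℝ, E₁) y.1) (b b' : TangentSpace 𝓘(ℝ, E₂) y.2) :
    inner ℝ (push E₁ E₂ E φ y a b : TangentSpace 𝓘(ℝ, E) (φ y)) (push E₁ E₂ E φ y a' b') =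
      inner ℝ a a' + f y.1 ^ 2 * inner ℝ b b' := by
  refine (hφ.isometric y _ _).trans ?_
  rw [warpedMetric, mfderiv_fst_tangentPair, mfderiv_fst_tangentPair, mfderiv_snd_tangentPair,
    mfderiv_snd_tangentPair]

/-- Naming the manifold point `y` behind the coordinates `s` lets pointwise hypotheses on the
immersion be applied throughout a neighbourhood, as is needed before differentiating. -/
theorem IsWarpedSemiInvariant.fderiv_chartMap (hφ : IsWarpedSemiInvariant E₁ E₂ J f φ)
    (x : M₁ × M₂) : ∀ᶠ s in 𝓝 (extChartAt (𝓘(ℝ, E₁).prod 𝓘(ℝ, E₂)) x x),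
      ∃ y : M₁ × M₂, y = (extChartAt (𝓘(ℝ, E₁).prod 𝓘(ℝ, E₂)) x).symm s ∧
        s ∈ (extChartAt (𝓘(ℝ, E₁).prod 𝓘(ℝ, E₂)) x).target ∧
        φ y ∈ (chartAt E (φ x)).source ∧
        (extChartAt 𝓘(ℝ, E) (φ x)).symm (chartMap E (𝓘(ℝ, E₁).prod 𝓘(ℝ, E₂)) φ x s) = φ y ∧
        ∀ u : E₁ × E₂, fderiv ℝ (chartMap E (𝓘(ℝ, E₁).prod 𝓘(ℝ, E₂)) φ x) s u =
      (trivializationAt E (TangentSpace 𝓘(ℝ, E) : M → Type _) (φ x)).continuousLinearMapAt ℝ (φ y)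
        (push E₁ E₂ E φ y
          ((trivializationAt E₁ (TangentSpace 𝓘(ℝ, E₁) : M₁ → Type _) x.1).symmL ℝ y.1 u.1)
          ((trivializationAt E₂ (TangentSpace 𝓘(ℝ, E₂) : M₂ → Type _) x.2).symmL ℝ y.2 u.2)) := by
  filter_upwards [eventually_chartMap_prod (E := E) (hφ.mdifferentiable x).continuousAt] with s hs
  refine ⟨_, rfl, hs.1, hs.2, ?_, fderiv_chartMap_prod hφ.mdifferentiable hs.1 rfl hs.2⟩
  exact (extChartAt 𝓘(ℝ, E) (φ x)).left_inv (by simpa using hs.2)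

/-- This is the isometry hypothesis read in charts, with the squared warping function as `h`. -/
theorem IsWarpedSemiInvariant.isWarpedNear (hφ : IsWarpedSemiInvariant E₁ E₂ J f φ)
    (x : M₁ × M₂) :
    IsWarpedNear (chartMetric (φ x)) (chartMap E (𝓘(ℝ, E₁).prod 𝓘(ℝ, E₂)) φ x)
      (extChartAt (𝓘(ℝ, E₁).prod 𝓘(ℝ, E₂)) x x) (chartMetric x.1) (chartMetric x.2)
      (fun r ↦ f ((extChartAt 𝓘(ℝ, E₁) x.1).symm r) ^ 2) := by
  filter_upwards [hφ.fderiv_chartMap x] with s hs u v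
  obtain ⟨y, hy, hs, hφy, hψ, hd⟩ := hs
  rw [hd, hd, chartMetric, hψ, metricCoeff_continuousLinearMapAt hφy, hφ.inner_push, chartMetric,
    chartMetric, metricCoeff_apply, metricCoeff_apply, hy]
  rfl

theorem push_fst_mem (hφ : IsWarpedSemiInvariant E₁ E₂ J f φ) (y : M₁ × M₂)
    (a : TangentSpace 𝓘(ℝ, E₁) y.1) : push E₁ E₂ E φ y a 0 ∈ tangentFst E₁ E φ y :=
  ⟨a, mfderiv_slice_fst hφ.mdifferentiable y a⟩

theorem push_snd_mem (hφ : IsWarpedSemiInvariant E₁ E₂ J f φ) (y : M₁ × M₂)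
    (b : TangentSpace 𝓘(ℝ, E₂) y.2) : push E₁ E₂ E φ y 0 b ∈ tangentSnd E₂ E φ y :=
  ⟨b, mfderiv_slice_snd hφ.mdifferentiable y b⟩

theorem IsWarpedSemiInvariant.exists_map_push_snd (hφ : IsWarpedSemiInvariant E₁ E₂ J f φ)
    (y : M₁ × M₂) (b : TangentSpace 𝓘(ℝ, E₂) y.2) :
    ∃ c : TangentSpace 𝓘(ℝ, E₂) y.2, J (φ y) (push E₁ E₂ E φ y 0 b) = push E₁ E₂ E φ y 0 c := by
  obtain ⟨c, hc⟩ := hφ.invariant y _ (push_snd_mem hφ y b)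
  exact ⟨c, hc.symm.trans (mfderiv_slice_snd hφ.mdifferentiable y c)⟩

theorem IsWarpedSemiInvariant.inner_map_snd_fst (hφ : IsWarpedSemiInvariant E₁ E₂ J f φ)
    (y : M₁ × M₂) (b : TangentSpace 𝓘(ℝ, E₂) y.2) (a : TangentSpace 𝓘(ℝ, E₁) y.1) :
    inner ℝ (J (φ y) (push E₁ E₂ E φ y 0 b)) (push E₁ E₂ E φ y a 0) = 0 := by
  obtain ⟨c, hc⟩ := hφ.exists_map_push_snd y b
  rw [hc, hφ.inner_push, inner_zero_left, inner_zero_right, mul_zero, add_zero]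

/-- The components of the horizontal lift of `X`, in charts. -/
theorem IsWarpedSemiInvariant.alongCoord_liftFst (hφ : IsWarpedSemiInvariant E₁ E₂ J f φ)
    (X : Π x : M₁, TangentSpace 𝓘(ℝ, E₁) x) (x : M₁ × M₂) :
    alongCoord (E := E) φ (fun y ↦ push E₁ E₂ E φ y (X y.1) 0) x ∘
        (extChartAt (𝓘(ℝ, E₁).prod 𝓘(ℝ, E₂)) x).symm
      =ᶠ[𝓝 (extChartAt (𝓘(ℝ, E₁).prod 𝓘(ℝ, E₂)) x x)]
      fun s ↦ fderiv ℝ (chartMap E (𝓘(ℝ, E₁).prod 𝓘(ℝ, E₂)) φ x) s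
        (alongCoord (fun y : M₁ ↦ y) X x.1 ((extChartAt 𝓘(ℝ, E₁) x.1).symm s.1), 0) := by
  filter_upwards [hφ.fderiv_chartMap x] with s hs
  obtain ⟨y, hy, hs, hφy, hψ, hd⟩ := hs
  rw [hd, Function.comp_apply, ← hy, alongCoord, trivializationAt_snd hφy]
  have hy₁ : y.1 = (extChartAt 𝓘(ℝ, E₁) x.1).symm s.1 := congrArg Prod.fst hy
  have hmem : y.1 ∈ (chartAt E₁ x.1).source := by
    rw [hy₁]
    simpa using (extChartAt 𝓘(ℝ, E₁) x.1).map_target (mem_extChartAt_prod_target.1 hs).1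
  rw [← hy₁, alongCoord, trivializationAt_snd hmem,
    Trivialization.symmL_continuousLinearMapAt _ (by simpa using hmem), map_zero]

theorem IsWarpedSemiInvariant.contDiffAt_chartMap (hφ : IsWarpedSemiInvariant E₁ E₂ J f φ)
    (x : M₁ × M₂) : ContDiffAt ℝ 2 (chartMap E (𝓘(ℝ, E₁).prod 𝓘(ℝ, E₂)) φ x)
      (extChartAt (𝓘(ℝ, E₁).prod 𝓘(ℝ, E₂)) x x) :=
  (MetallicGeometry.contDiffAt_chartMap (hφ.smooth x)).of_le ENat.LEInfty.out

theorem IsWarpedSemiInvariant.mdifferentiableAt_alongCoord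
    (hφ : IsWarpedSemiInvariant E₁ E₂ J f φ)
    {X : Π x : M₁, TangentSpace 𝓘(ℝ, E₁) x} (x : M₁ × M₂)
    (hX : MDifferentiableAt 𝓘(ℝ, E₁) 𝓘(ℝ, E₁) (alongCoord (fun y : M₁ ↦ y) X x.1) x.1) :
    MDifferentiableAt (𝓘(ℝ, E₁).prod 𝓘(ℝ, E₂)) 𝓘(ℝ, E)
      (alongCoord (E := E) φ (fun y ↦ push E₁ E₂ E φ y (X y.1) 0) x) x := by
  refine mdifferentiableAt_of_comp_extChartAt_symm ?_
  refine DifferentiableAt.congr_of_eventuallyEq ?_ (hφ.alongCoord_liftFst X x)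
  exact (hasFDerivAt_fderiv_fst (hφ.contDiffAt_chartMap x)
    (differentiableAt_comp_extChartAt_symm hX)).differentiableAt

/-- Identifies `∇̄_Z X` with the model quantity to which the Koszul computations apply. -/
theorem IsWarpedSemiInvariant.covAlong_push
    (hφ : IsWarpedSemiInvariant E₁ E₂ J f φ)
    {X : Π x : M₁, TangentSpace 𝓘(ℝ, E₁) x} (x : M₁ × M₂)
    (hX : MDifferentiableAt 𝓘(ℝ, E₁) 𝓘(ℝ, E₁) (alongCoord (fun y : M₁ ↦ y) X x.1) x.1)
    (z : E₂) :
    @Eq E (covAlong (𝓘(ℝ, E₁).prod 𝓘(ℝ, E₂)) φ (fun y ↦ push E₁ E₂ E φ y (X y.1) 0) x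
        (((0, z) : E₁ × E₂)))
      (secondCov (chartChristoffel E (φ x)) (chartMap E (𝓘(ℝ, E₁).prod 𝓘(ℝ, E₂)) φ x)
        (extChartAt (𝓘(ℝ, E₁).prod 𝓘(ℝ, E₂)) x x) (0, z)
        (alongCoord (fun y : M₁ ↦ y) X x.1 x.1, 0)) := by
  refine (covAlong_eq_chart (hφ.mdifferentiable x) (hφ.mdifferentiableAt_alongCoord x hX)
    (0, z)).trans ?_
  have h0 : (extChartAt 𝓘(ℝ, E₁) x.1).symm
      (extChartAt (𝓘(ℝ, E₁).prod 𝓘(ℝ, E₂)) x x).1 = x.1 := extChartAt_to_inv x.1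
  have hv := (hφ.alongCoord_liftFst X x).eq_of_nhds
  rw [Function.comp_apply, extChartAt_to_inv, h0] at hv
  rw [secondCov, (hφ.alongCoord_liftFst X x).fderiv_eq, hv]
  congr 1
  have hξ : (alongCoord (fun y : M₁ ↦ y) X x.1 ∘ (extChartAt 𝓘(ℝ, E₁) x.1).symm)
      (extChartAt (𝓘(ℝ, E₁).prod 𝓘(ℝ, E₂)) x x).1 = alongCoord (fun y : M₁ ↦ y) X x.1 x.1 :=
    congrArg (alongCoord (fun y : M₁ ↦ y) X x.1) h0
  rw [← hξ]
  exact fderiv_fderiv_fst_apply_snd (hφ.contDiffAt_chartMap x)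
    (differentiableAt_comp_extChartAt_symm hX) z

theorem chartMetric_chartMap (φ : M₁ × M₂ → M) (x : M₁ × M₂) (v w : TangentSpace 𝓘(ℝ, E) (φ x)) :
    chartMetric (φ x) (chartMap E (𝓘(ℝ, E₁).prod 𝓘(ℝ, E₂)) φ x
      (extChartAt (𝓘(ℝ, E₁).prod 𝓘(ℝ, E₂)) x x)) v w = inner ℝ v w := by
  rw [chartMap_self, chartMetric_self]
  exact metricCoeff_self (E := E) (φ x) v w

theorem IsWarpedSemiInvariant.push_eq_fderiv (hφ : IsWarpedSemiInvariant E₁ E₂ J f φ)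
    (x : M₁ × M₂) (a : E₁) (b : E₂) :
    @Eq E (push E₁ E₂ E φ x a b) (fderiv ℝ (chartMap E (𝓘(ℝ, E₁).prod 𝓘(ℝ, E₂)) φ x)
      (extChartAt (𝓘(ℝ, E₁).prod 𝓘(ℝ, E₂)) x x) (a, b)) :=
  mfderiv_apply_eq_fderiv (hφ.mdifferentiable x) (tangentPair x a b)

theorem IsWarpedSemiInvariant.fderiv_sq (hφ : IsWarpedSemiInvariant E₁ E₂ J f φ) (x : M₁) (a : E₁) :
    DifferentiableAt ℝ (fun r ↦ f ((extChartAt 𝓘(ℝ, E₁) x).symm r) ^ 2) (extChartAt 𝓘(ℝ, E₁) x x) ∧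
    fderiv ℝ (fun r ↦ f ((extChartAt 𝓘(ℝ, E₁) x).symm r) ^ 2) (extChartAt 𝓘(ℝ, E₁) x x) a =
      2 * f x * mvfderiv 𝓘(ℝ, E₁) f x a := by
  have hf : MDifferentiableAt 𝓘(ℝ, E₁) 𝓘(ℝ, ℝ) f x :=
    (hφ.smooth_warping x).mdifferentiableAt (by simp)
  have hd := differentiableAt_comp_extChartAt_symm hf
  have h2 := hd.hasFDerivAt.pow 2
  refine ⟨h2.differentiableAt, ?_⟩
  have e : mvfderiv 𝓘(ℝ, E₁) f x a =
      fderiv ℝ (f ∘ (extChartAt 𝓘(ℝ, E₁) x).symm) (extChartAt 𝓘(ℝ, E₁) x x) a :=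
    mvfderiv_apply_eq_fderiv hf a
  refine Eq.trans ?_ (congrArg (fun t ↦ 2 * f x * t) e.symm)
  refine (DFunLike.congr_fun (HasFDerivAt.fderiv
    (f := fun r ↦ f ((extChartAt 𝓘(ℝ, E₁) x).symm r) ^ 2) h2) a).trans ?_
  simp

variable {X : Π x : M₁, TangentSpace 𝓘(ℝ, E₁) x}

/-- The mixed covariant derivative has no component along the first factor. -/
theorem IsWarpedSemiInvariant.inner_covAlong_fst (hφ : IsWarpedSemiInvariant E₁ E₂ J f φ)
    (x : M₁ × M₂)
    (hX : MDifferentiableAt 𝓘(ℝ, E₁) 𝓘(ℝ, E₁) (alongCoord (fun y : M₁ ↦ y) X x.1) x.1)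
    (z : TangentSpace 𝓘(ℝ, E₂) x.2) (a : TangentSpace 𝓘(ℝ, E₁) x.1) :
    inner ℝ (covAlong (𝓘(ℝ, E₁).prod 𝓘(ℝ, E₂)) φ (fun y ↦ push E₁ E₂ E φ y (X y.1) 0) x
      (tangentPair x 0 z)) (push E₁ E₂ E φ x a 0) = 0 := by
  have hG : DifferentiableAt ℝ (chartMetric (φ x)) (chartMap E (𝓘(ℝ, E₁).prod 𝓘(ℝ, E₂)) φ x
      (extChartAt (𝓘(ℝ, E₁).prod 𝓘(ℝ, E₂)) x x)) := by
    rw [chartMap_self]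
    exact differentiableAt_chartMetric (φ x)
  have hC : IsChristoffelAt (chartMetric (φ x)) (chartMap E (𝓘(ℝ, E₁).prod 𝓘(ℝ, E₂)) φ x
      (extChartAt (𝓘(ℝ, E₁).prod 𝓘(ℝ, E₂)) x x)) (chartChristoffel E (φ x)) := by
    rw [chartMap_self]
    exact isChristoffelAt_chartChristoffel (φ x)
  have key := (hφ.isWarpedNear x).secondCov_fst (differentiableAt_chartMetric x.1)
    (differentiableAt_chartMetric x.2) (hφ.fderiv_sq x.1 0).1 hC hG (chartMetric_symm (φ x))
    (hφ.contDiffAt_chartMap x) z (alongCoord (fun y : M₁ ↦ y) X x.1 x.1) a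
  rw [← hφ.covAlong_push x hX z, ← hφ.push_eq_fderiv x a 0] at key
  exact (chartMetric_chartMap φ x _ _).symm.trans key

/-- With `h = f²` the model identity reads `2⟨∇̄_Z X, b⟩ = 2f X(f) g₂(z, b)`. -/
theorem IsWarpedSemiInvariant.inner_covAlong_snd (hφ : IsWarpedSemiInvariant E₁ E₂ J f φ)
    (x : M₁ × M₂)
    (hX : MDifferentiableAt 𝓘(ℝ, E₁) 𝓘(ℝ, E₁) (alongCoord (fun y : M₁ ↦ y) X x.1) x.1)
    (z b : TangentSpace 𝓘(ℝ, E₂) x.2) :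
    inner ℝ (covAlong (𝓘(ℝ, E₁).prod 𝓘(ℝ, E₂)) φ (fun y ↦ push E₁ E₂ E φ y (X y.1) 0) x
      (tangentPair x 0 z)) (push E₁ E₂ E φ x 0 b) =
      f x.1 * mvfderiv 𝓘(ℝ, E₁) f x.1 (X x.1) * inner ℝ z b := by
  have hG : DifferentiableAt ℝ (chartMetric (φ x)) (chartMap E (𝓘(ℝ, E₁).prod 𝓘(ℝ, E₂)) φ x
      (extChartAt (𝓘(ℝ, E₁).prod 𝓘(ℝ, E₂)) x x)) := by
    rw [chartMap_self]
    exact differentiableAt_chartMetric (φ x)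
  have hC : IsChristoffelAt (chartMetric (φ x)) (chartMap E (𝓘(ℝ, E₁).prod 𝓘(ℝ, E₂)) φ x
      (extChartAt (𝓘(ℝ, E₁).prod 𝓘(ℝ, E₂)) x x)) (chartChristoffel E (φ x)) := by
    rw [chartMap_self]
    exact isChristoffelAt_chartChristoffel (φ x)
  have hXx : @Eq E₁ (alongCoord (fun y : M₁ ↦ y) X x.1 x.1) (X x.1) :=
    alongCoord_self (fun y : M₁ ↦ y) X x.1
  have key := (hφ.isWarpedNear x).secondCov_snd (differentiableAt_chartMetric x.1)
    (differentiableAt_chartMetric x.2) (hφ.fderiv_sq x.1 0).1 hC hG (chartMetric_symm (φ x))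
    (hφ.contDiffAt_chartMap x) z b (alongCoord (fun y : M₁ ↦ y) X x.1 x.1)
  rw [← hφ.covAlong_push x hX z, ← hφ.push_eq_fderiv x 0 b, extChartAt_prod_apply,
    (hφ.fderiv_sq x.1 _).2, hXx, chartMetric_self] at key
  have hz : metricCoeff E₂ x.2 x.2 z b = inner ℝ z b := metricCoeff_self (E := E₂) x.2 z b
  rw [hz] at key
  refine mul_left_cancel₀ two_ne_zero ((congrArg (fun t : ℝ ↦ 2 * t)
    (chartMetric_chartMap φ x _ _).symm).trans (key.trans ?_))
  ring

/-- Transfers `secondCov_map_fst` to the manifold; its four assumptions on `J` are parallelism,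
self-adjointness, invariance of the second factor, and orthogonality of `JZ` to the first factor
near the point. -/
theorem IsWarpedSemiInvariant.inner_covAlong_map_fst (hφ : IsWarpedSemiInvariant E₁ E₂ J f φ)
    {p q : ℕ} (hJ : IsLocallyMetallic p q J) (x : M₁ × M₂)
    (hX : MDifferentiableAt 𝓘(ℝ, E₁) 𝓘(ℝ, E₁) (alongCoord (fun y : M₁ ↦ y) X x.1) x.1)
    (z : TangentSpace 𝓘(ℝ, E₂) x.2) (a : TangentSpace 𝓘(ℝ, E₁) x.1) :
    inner ℝ (covAlong (𝓘(ℝ, E₁).prod 𝓘(ℝ, E₂)) φ (fun y ↦ push E₁ E₂ E φ y (X y.1) 0) x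
      (tangentPair x 0 z)) (J (φ x) (push E₁ E₂ E φ x a 0)) = 0 := by
  have hG : DifferentiableAt ℝ (chartMetric (φ x)) (chartMap E (𝓘(ℝ, E₁).prod 𝓘(ℝ, E₂)) φ x
      (extChartAt (𝓘(ℝ, E₁).prod 𝓘(ℝ, E₂)) x x)) := by
    rw [chartMap_self]
    exact differentiableAt_chartMetric (φ x)
  have hC : IsChristoffelAt (chartMetric (φ x)) (chartMap E (𝓘(ℝ, E₁).prod 𝓘(ℝ, E₂)) φ x
      (extChartAt (𝓘(ℝ, E₁).prod 𝓘(ℝ, E₂)) x x)) (chartChristoffel E (φ x)) := by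
    rw [chartMap_self]
    exact isChristoffelAt_chartChristoffel (φ x)
  have hEd : DifferentiableAt ℝ (chartEndo J (φ x)) (chartMap E (𝓘(ℝ, E₁).prod 𝓘(ℝ, E₂)) φ x
      (extChartAt (𝓘(ℝ, E₁).prod 𝓘(ℝ, E₂)) x x)) := by
    rw [chartMap_self]
    exact differentiableAt_comp_extChartAt_symm (mdifferentiableAt_endoCoeff hJ.smooth (φ x))
  have hself : ∀ v : TangentSpace 𝓘(ℝ, E) (φ x),
      @Eq E (chartEndo J (φ x) (chartMap E (𝓘(ℝ, E₁).prod 𝓘(ℝ, E₂)) φ x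
        (extChartAt (𝓘(ℝ, E₁).prod 𝓘(ℝ, E₂)) x x)) v) (J (φ x) v) := by
    intro v
    rw [chartMap_self, chartEndo_self]
    exact endoCoeff_self (E := E) (φ x) v
  have key := (hφ.isWarpedNear x).secondCov_map_fst (differentiableAt_chartMetric x.1)
    (differentiableAt_chartMetric x.2) (hφ.fderiv_sq x.1 0).1 hC hG (chartMetric_symm (φ x))
    (hφ.contDiffAt_chartMap x) hEd ?_ ?_ ?_ ?_ z (alongCoord (fun y : M₁ ↦ y) X x.1 x.1) a
  · rw [← hφ.covAlong_push x hX z, ← hφ.push_eq_fderiv x a 0, hself] at key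
    exact (chartMetric_chartMap φ x _ _).symm.trans key
  · intro v w
    rw [chartMap_self, chartEndo_self]
    exact hJ.fderiv_chartEndo (φ x) v w
  · intro v w
    refine (congrArg (fun t : E ↦ chartMetric (φ x) _ t w) (hself v)).trans ?_
    refine Eq.trans ?_ (congrArg (fun t : E ↦ chartMetric (φ x) _ v t) (hself w)).symm
    refine (chartMetric_chartMap φ x (J (φ x) v) w).trans ?_
    exact (hJ.symm (φ x) v w).trans (chartMetric_chartMap φ x v (J (φ x) w)).symm
  · intro b
    obtain ⟨c, hc⟩ := hφ.exists_map_push_snd x b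
    refine ⟨c, ?_⟩
    rw [← hφ.push_eq_fderiv x 0 b, ← hφ.push_eq_fderiv x 0 c]
    exact (hself _).trans hc
  · filter_upwards [hφ.fderiv_chartMap x] with s hs b c
    obtain ⟨y, hy, hs, hφy, hψ, hd⟩ := hs
    rw [hd, hd, chartMetric, chartEndo, hψ, endoCoeff_apply_continuousLinearMapAt J hφy,
      metricCoeff_continuousLinearMapAt hφy]
    rw [map_zero, map_zero]
    exact hφ.inner_map_snd_fst y _ _

end Warped

/-! ### Pointwise linear algebra of the Weingarten terms. -/

section LinearAlgebra

variable {V : Type*} [NormedAddCommGroup V] [InnerProductSpace ℝ V]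

/-- A vector of a subspace which has the same inner products with that subspace as `w` is the
orthogonal projection of `w`. -/
theorem orthogonalProjectionOnto_eq_of_inner {S : Submodule ℝ V} [S.HasOrthogonalProjection]
    {u w : V} (hu : u ∈ S) (h : ∀ s ∈ S, inner ℝ w s = inner ℝ u s) :
    (S.orthogonalProjectionOnto w : V) = u := by
  rw [← Submodule.starProjection_apply]
  refine Submodule.eq_starProjection_of_mem_of_inner_eq_zero hu fun s hs ↦ ?_
  rw [inner_sub_left, h s hs, sub_self]

/-- The tangential and normal parts of `J w` for a metallic structure `J` at a point of a
semi-invariant submanifold with tangent space `S = P₁ ⊕ P₂`, when the tangential part of `w` is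
`c • z` with `z ∈ P₂`. -/
theorem weingarten_sum_eq {S P₁ P₂ : Submodule ℝ V} [S.HasOrthogonalProjection] {J : V →L[ℝ] V}
    {p q c : ℝ} {w z : V} (hsq : ∀ v, J (J v) = p • J v + q • v)
    (hsymm : ∀ v v', inner ℝ (J v) v' = inner ℝ v (J v'))
    (h₂ : P₂ ≤ S) (hS : ∀ s ∈ S, ∃ a ∈ P₁, ∃ b ∈ P₂, a + b = s)
    (horth : ∀ a ∈ P₁, ∀ b ∈ P₂, inner ℝ a b = 0) (hinv : ∀ b ∈ P₂, J b ∈ P₂)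
    (hz : z ∈ P₂) (hw₁ : ∀ a ∈ P₁, inner ℝ w a = 0) (hwJ : ∀ a ∈ P₁, inner ℝ w (J a) = 0)
    (hw₂ : ∀ b ∈ P₂, inner ℝ w b = c * inner ℝ z b) :
    ((S.orthogonalProjectionOnto (J ((-S.orthogonalProjectionOnto (J w) : S) : V))
      - p • (-S.orthogonalProjectionOnto (J w))
      + S.orthogonalProjectionOnto (J (Sᗮ.orthogonalProjectionOnto (J w))) : S) : V)
      = -((q * c) • z) := by
  have hzS := h₂ hz
  have hJz := hinv z hz
  have hW : (S.orthogonalProjectionOnto w : V) = c • z := by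
    refine orthogonalProjectionOnto_eq_of_inner (S.smul_mem c hzS) fun s hs ↦ ?_
    obtain ⟨a, ha, b, hb, rfl⟩ := hS s hs
    rw [inner_add_right, inner_add_right, hw₁ a ha, hw₂ b hb, inner_smul_left, inner_smul_left,
      real_inner_comm a z, horth a ha z hz]
    simp
  -- Move `J` across the inner product: on `P₁` it gives zero by `hwJ`, and on `P₂`, which `J`
  -- preserves, it gives `c⟨z, Jb⟩ = c⟨Jz, b⟩`.
  have hA : (S.orthogonalProjectionOnto (J w) : V) = c • J z := by
    refine orthogonalProjectionOnto_eq_of_inner (S.smul_mem c (h₂ hJz)) fun s hs ↦ ?_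
    obtain ⟨a, ha, b, hb, rfl⟩ := hS s hs
    rw [hsymm, map_add, inner_add_right, inner_add_right, hwJ a ha, hw₂ _ (hinv b hb),
      inner_smul_left, inner_smul_left, real_inner_comm a (J z), horth a ha _ hJz, hsymm z b]
    simp
  have hJJ : J (J z) ∈ S := h₂ (hinv _ hJz)
  have hD : ((Sᗮ.orthogonalProjectionOnto (J w) : Sᗮ) : V) = J w - c • J z := by
    rw [Submodule.orthogonalProjectionOnto_orthogonal, ← hA]
    rfl
  have hp : (S.orthogonalProjectionOnto (J (J z)) : V) = J (J z) := by
    rw [← Submodule.starProjection_apply]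
    exact Submodule.starProjection_eq_self_iff.2 hJJ
  push_cast
  -- `J` sends the normal part `Jw - cJz` to `pJw + qw - cJ²z`, whose tangential part `pcJz + qcz -
  -- cJ²z` is zero; what remains is `-cJ²z + pcJz = -qcz`.
  rw [hD, hA, map_neg, map_smul, map_sub, map_smul, hsq w]
  simp only [map_neg, map_smul, map_sub, map_add]
  push_cast
  rw [hp, hA, hW, hsq z]
  module

end LinearAlgebra

/-! ### Extension of tangent vectors, and functions with zero differential. -/

section Extension

variable {E : Type*} [NormedAddCommGroup E] [NormedSpace ℝ E] [FiniteDimensional ℝ E]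
  {M : Type*} [TopologicalSpace M] [T2Space M] [ChartedSpace E M] [IsManifold 𝓘(ℝ, E) ∞ M]

/-- The coordinate vector fields of a chart are smooth. -/
theorem contMDiffOn_symmL_trivializationAt (x : M) (a : E) :
    ContMDiffOn 𝓘(ℝ, E) (𝓘(ℝ, E).prod 𝓘(ℝ, E)) ∞
      (fun y : M ↦ (TotalSpace.mk' E y
        ((trivializationAt E (TangentSpace 𝓘(ℝ, E) : M → Type _) x).symmL ℝ y a) :
          TangentBundle 𝓘(ℝ, E) M))
      (trivializationAt E (TangentSpace 𝓘(ℝ, E) : M → Type _) x).baseSet := by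
  rw [Trivialization.contMDiffOn_section_baseSet_iff]
  refine (contMDiffOn_const (c := a)).congr fun y hy ↦ ?_
  rw [Trivialization.symmL_apply _ hy]
  exact congrArg Prod.snd (Trivialization.apply_mk_symm _ hy a)

/-- Every tangent vector extends to a smooth vector field. -/
theorem exists_contMDiff_vectorField (x : M) (v : TangentSpace 𝓘(ℝ, E) x) :
    ∃ X : Π y : M, TangentSpace 𝓘(ℝ, E) y, X x = v ∧
      ContMDiff 𝓘(ℝ, E) (𝓘(ℝ, E).prod 𝓘(ℝ, E)) ∞
        (fun y : M ↦ (TotalSpace.mk' E y (X y) : TangentBundle 𝓘(ℝ, E) M)) := by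
  let ψ : SmoothBumpFunction 𝓘(ℝ, E) x := Classical.arbitrary _
  let e := trivializationAt E (TangentSpace 𝓘(ℝ, E) : M → Type _) x
  let s : Π y : M, TangentSpace 𝓘(ℝ, E) y := fun y ↦ e.symmL ℝ y v
  -- The bump function is `1` at `x` and supported in the chart domain, where the coordinate field
  -- `s` is smooth.
  refine ⟨(ψ : M → ℝ) • s, ?_, ?_⟩
  · refine (congrArg (fun r : ℝ ↦ r • s x) ψ.eq_one).trans ((one_smul ℝ _).trans ?_)
    exact symmL_trivializationAt_self (E := E) x v
  · exact ContMDiffOn.smul_section_of_tsupport ψ.contMDiff.contMDiffOn e.open_baseSet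
      ψ.tsupport_subset_chartAt_source (contMDiffOn_symmL_trivializationAt (E := E) x v)

/-- A differentiable function whose differential vanishes everywhere is locally constant. -/
theorem isLocallyConstant_of_mvfderiv_eq_zero {f : M → ℝ}
    (hf : ContMDiff 𝓘(ℝ, E) 𝓘(ℝ, ℝ) ∞ f) (h : ∀ x, mvfderiv 𝓘(ℝ, E) f x = 0) :
    IsLocallyConstant f := by
  rw [IsLocallyConstant.iff_eventually_eq]
  intro x
  let κ := extChartAt 𝓘(ℝ, E) x
  have hopen : IsOpen κ.target := isOpen_extChartAt_target x
  have hd : ∀ e ∈ κ.target, HasFDerivAt (f ∘ κ.symm) (0 : E →L[ℝ] ℝ) e := by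
    intro e he
    have h1 : MDifferentiableAt 𝓘(ℝ, E) 𝓘(ℝ, E) κ.symm e :=
      ((contMDiffOn_extChartAt_symm (n := ∞) x).contMDiffAt (hopen.mem_nhds he)).mdifferentiableAt
        (by simp)
    have h2 : MDifferentiableAt 𝓘(ℝ, E) 𝓘(ℝ, ℝ) f (κ.symm e) :=
      (hf (κ.symm e)).mdifferentiableAt (by simp)
    have h3 : DifferentiableAt ℝ (f ∘ κ.symm) e := (h2.comp e h1).differentiableAt
    have h4 := mvfderiv_comp e h2 h1
    rw [h, ContinuousLinearMap.zero_comp] at h4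
    have h5 : fderiv ℝ (f ∘ κ.symm) e = 0 := by
      ext v
      exact (DFunLike.congr_fun mfderiv_eq_fderiv v).symm.trans (DFunLike.congr_fun h4 v)
    exact h5 ▸ h3.hasFDerivAt
  -- A ball inside the chart target is convex, so a zero derivative there forces constancy.
  obtain ⟨r, hr, hball⟩ := Metric.isOpen_iff.1 hopen (κ x) (mem_extChartAt_target x)
  filter_upwards [(continuousAt_extChartAt x).preimage_mem_nhds (Metric.ball_mem_nhds (κ x) hr),
    extChartAt_source_mem_nhds (I := 𝓘(ℝ, E)) x] with y hy hys
  have h6 : (f ∘ κ.symm) (κ y) = (f ∘ κ.symm) (κ x) :=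
    Metric.isOpen_ball.is_const_of_fderiv_eq_zero (𝕜 := ℝ)
      (convex_ball (κ x) r).isPreconnected
      (fun e he ↦ (hd e (hball he)).differentiableAt.differentiableWithinAt)
      (fun e he ↦ (hd e (hball he)).fderiv) hy (Metric.mem_ball_self hr)
  rw [Function.comp_apply, Function.comp_apply, κ.left_inv hys,
    κ.left_inv (mem_extChartAt_source x)] at h6
  exact h6

/-- Manifolds are locally connected, so components are open and `f` is constant near `x`. -/
theorem mvfderiv_eq_zero_of_connectedComponent {f : M → ℝ}
    (h : ∀ x y : M, y ∈ connectedComponent x → f y = f x) (x : M) :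
    mvfderiv 𝓘(ℝ, E) f x = 0 := by
  have := ChartedSpace.locallyConnectedSpace E M
  have h1 : f =ᶠ[𝓝 x] fun _ ↦ f x :=
    Filter.mem_of_superset (isOpen_connectedComponent.mem_nhds mem_connectedComponent)
      fun y hy ↦ h x y hy
  have h2 : HasMFDerivAt 𝓘(ℝ, E) 𝓘(ℝ, ℝ) f x
      (0 : TangentSpace 𝓘(ℝ, E) x →L[ℝ] TangentSpace 𝓘(ℝ, ℝ) (f x)) :=
    (hasMFDerivAt_const (f x) x).congr_of_eventuallyEq h1
  ext v
  exact congrFun (congrArg DFunLike.coe h2.mfderiv) v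

end Extension

/-! ### The shape operator condition at a point. -/

section Warped

variable {E₁ : Type*} [NormedAddCommGroup E₁] [NormedSpace ℝ E₁] [FiniteDimensional ℝ E₁]
  {E₂ : Type*} [NormedAddCommGroup E₂] [NormedSpace ℝ E₂] [FiniteDimensional ℝ E₂]
  {E : Type*} [NormedAddCommGroup E] [NormedSpace ℝ E] [FiniteDimensional ℝ E]
  {M₁ : Type*} [TopologicalSpace M₁] [ChartedSpace E₁ M₁] [IsManifold 𝓘(ℝ, E₁) ∞ M₁]
  [RiemannianBundle (fun x : M₁ ↦ TangentSpace 𝓘(ℝ, E₁) x)]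
  [IsContMDiffRiemannianBundle 𝓘(ℝ, E₁) ∞ E₁ (fun x : M₁ ↦ TangentSpace 𝓘(ℝ, E₁) x)]
  {M₂ : Type*} [TopologicalSpace M₂] [ChartedSpace E₂ M₂] [IsManifold 𝓘(ℝ, E₂) ∞ M₂]
  [RiemannianBundle (fun x : M₂ ↦ TangentSpace 𝓘(ℝ, E₂) x)]
  [IsContMDiffRiemannianBundle 𝓘(ℝ, E₂) ∞ E₂ (fun x : M₂ ↦ TangentSpace 𝓘(ℝ, E₂) x)]
  {M : Type*} [TopologicalSpace M] [ChartedSpace E M] [IsManifold 𝓘(ℝ, E) ∞ M]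
  [RiemannianBundle (fun x : M ↦ TangentSpace 𝓘(ℝ, E) x)]
  [IsContMDiffRiemannianBundle 𝓘(ℝ, E) ∞ E (fun x : M ↦ TangentSpace 𝓘(ℝ, E) x)]
  {J : Π x : M, TangentSpace 𝓘(ℝ, E) x →L[ℝ] TangentSpace 𝓘(ℝ, E) x}
  {f : M₁ → ℝ} {φ : M₁ × M₂ → M}

theorem push_add_push (φ : M₁ × M₂ → M) (y : M₁ × M₂) (a : TangentSpace 𝓘(ℝ, E₁) y.1)
    (b : TangentSpace 𝓘(ℝ, E₂) y.2) :
    push E₁ E₂ E φ y a 0 + push E₁ E₂ E φ y 0 b = push E₁ E₂ E φ y a b := by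
  rw [push, push, push, ← map_add]
  refine congrArg (mfderiv (𝓘(ℝ, E₁).prod 𝓘(ℝ, E₂)) 𝓘(ℝ, E) φ y) ?_
  exact Prod.ext (add_zero (show E₁ from a)) (zero_add (show E₂ from b))

theorem IsWarpedSemiInvariant.tangentSnd_le (hφ : IsWarpedSemiInvariant E₁ E₂ J f φ)
    (x : M₁ × M₂) :
    tangentSnd E₂ E φ x ≤ tangentSub E (𝓘(ℝ, E₁).prod 𝓘(ℝ, E₂)) φ x := by
  rintro _ ⟨b, rfl⟩
  exact ⟨tangentPair x 0 b, (mfderiv_slice_snd hφ.mdifferentiable x b).symm⟩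

theorem IsWarpedSemiInvariant.push_snd_eq_zero_iff (hφ : IsWarpedSemiInvariant E₁ E₂ J f φ)
    (x : M₁ × M₂) (b : TangentSpace 𝓘(ℝ, E₂) x.2) : push E₁ E₂ E φ x 0 b = 0 ↔ b = 0 := by
  have h := hφ.inner_push x 0 0 b b
  rw [inner_zero_left, zero_add] at h
  rw [← inner_self_eq_zero (𝕜 := ℝ), h, mul_eq_zero, inner_self_eq_zero]
  simp [(hφ.warping_pos x.1).ne']

theorem mdifferentiableAt_alongCoord_id {X : Π x : M₁, TangentSpace 𝓘(ℝ, E₁) x}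
    (hX : ContMDiff 𝓘(ℝ, E₁) (𝓘(ℝ, E₁).prod 𝓘(ℝ, E₁)) ∞
      (fun x : M₁ ↦ (TotalSpace.mk' E₁ x (X x) : TangentBundle 𝓘(ℝ, E₁) M₁))) (x : M₁) :
    MDifferentiableAt 𝓘(ℝ, E₁) 𝓘(ℝ, E₁) (alongCoord (fun y : M₁ ↦ y) X x) x :=
  ((contMDiffAt_section x).1 (hX x)).mdifferentiableAt (by simp)

/-- The covariant derivative of `JX` in the direction of the second factor. -/
theorem IsWarpedSemiInvariant.covAlong_map_push (hφ : IsWarpedSemiInvariant E₁ E₂ J f φ)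
    {p q : ℕ} (hJ : IsLocallyMetallic p q J) {X : Π x : M₁, TangentSpace 𝓘(ℝ, E₁) x}
    (x : M₁ × M₂)
    (hX : MDifferentiableAt 𝓘(ℝ, E₁) 𝓘(ℝ, E₁) (alongCoord (fun y : M₁ ↦ y) X x.1) x.1)
    (z : TangentSpace 𝓘(ℝ, E₂) x.2) :
    covAlong (𝓘(ℝ, E₁).prod 𝓘(ℝ, E₂)) φ (fun y ↦ J (φ y) (push E₁ E₂ E φ y (X y.1) 0)) x
        (tangentPair x 0 z) =
      J (φ x) (covAlong (𝓘(ℝ, E₁).prod 𝓘(ℝ, E₂)) φ (fun y ↦ push E₁ E₂ E φ y (X y.1) 0) x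
        (tangentPair x 0 z)) :=
  hJ.covAlong_map (hφ.mdifferentiable x) (hφ.mdifferentiableAt_alongCoord x hX) _

/-- The difference of the two sides of the shape operator condition. -/
theorem IsWarpedSemiInvariant.shapeOperator_sum_eq (hφ : IsWarpedSemiInvariant E₁ E₂ J f φ)
    {p q : ℕ} (hJ : IsLocallyMetallic p q J) {X : Π x : M₁, TangentSpace 𝓘(ℝ, E₁) x}
    (x : M₁ × M₂)
    (hX : MDifferentiableAt 𝓘(ℝ, E₁) 𝓘(ℝ, E₁) (alongCoord (fun y : M₁ ↦ y) X x.1) x.1)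
    (z : TangentSpace 𝓘(ℝ, E₂) x.2) :
    let V : Π y : M₁ × M₂, TangentSpace 𝓘(ℝ, E) (φ y) :=
      fun y ↦ J (φ y) (push E₁ E₂ E φ y (X y.1) 0)
    let A := shapeOperator (𝓘(ℝ, E₁).prod 𝓘(ℝ, E₂)) φ V x (tangentPair x 0 z)
    ((opT (𝓘(ℝ, E₁).prod 𝓘(ℝ, E₂)) φ J x A - (p : ℝ) • A +
      opt (𝓘(ℝ, E₁).prod 𝓘(ℝ, E₂)) φ J x
        (normalConnection (𝓘(ℝ, E₁).prod 𝓘(ℝ, E₂)) φ V x (tangentPair x 0 z)) :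
        tangentSub E (𝓘(ℝ, E₁).prod 𝓘(ℝ, E₂)) φ x) : TangentSpace 𝓘(ℝ, E) (φ x)) =
      -(((q : ℝ) * (mvfderiv 𝓘(ℝ, E₁) f x.1 (X x.1) / f x.1)) • push E₁ E₂ E φ x 0 z) := by
  intro V A
  simp only [A, opT, opt, shapeOperator, normalConnection, tangentPart, normalPart, normalSub]
  rw [hφ.covAlong_map_push hJ x hX z]
  have hfst : ∀ a ∈ tangentFst E₁ E φ x, ∃ a', a = push E₁ E₂ E φ x a' 0 := by
    rintro _ ⟨a, rfl⟩
    exact ⟨a, mfderiv_slice_fst hφ.mdifferentiable x a⟩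
  have hsnd : ∀ b ∈ tangentSnd E₂ E φ x, ∃ b', b = push E₁ E₂ E φ x 0 b' := by
    rintro _ ⟨b, rfl⟩
    exact ⟨b, mfderiv_slice_snd hφ.mdifferentiable x b⟩
  refine weingarten_sum_eq (P₁ := tangentFst E₁ E φ x) (P₂ := tangentSnd E₂ E φ x) (hJ.sq (φ x))
    (hJ.symm (φ x)) (hφ.tangentSnd_le x) ?_ ?_ (hφ.invariant x) (push_snd_mem hφ x z) ?_ ?_ ?_
  · rintro _ ⟨u, rfl⟩
    exact ⟨_, push_fst_mem hφ x (show E₁ × E₂ from u).1, _,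
      push_snd_mem hφ x (show E₁ × E₂ from u).2, push_add_push φ x _ _⟩
  · intro a ha b hb
    obtain ⟨a, rfl⟩ := hfst a ha
    obtain ⟨b, rfl⟩ := hsnd b hb
    rw [hφ.inner_push, inner_zero_left, inner_zero_right, mul_zero, add_zero]
  · intro a ha
    obtain ⟨a, rfl⟩ := hfst a ha
    exact hφ.inner_covAlong_fst x hX z a
  · intro a ha
    obtain ⟨a, rfl⟩ := hfst a ha
    exact hφ.inner_covAlong_map_fst hJ x hX z a
  · intro b hb
    obtain ⟨b, rfl⟩ := hsnd b hb
    refine (hφ.inner_covAlong_snd x hX z b).trans ?_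
    -- The ambient product on the second factor is `f² g₂`, so `f X(f) g₂(z, b)` is `X(f)/f` times
    -- it; this is the origin of the constant `c`.
    rw [hφ.inner_push, inner_zero_left, zero_add]
    have := (hφ.warping_pos x.1).ne'
    field_simp

/-- The two sides differ by `-q (X(f)/f) Z`, with `q` and `f` nonzero and the differential of the
immersion injective on the second factor. -/
theorem IsWarpedSemiInvariant.shapeOperator_condition_iff
    (hφ : IsWarpedSemiInvariant E₁ E₂ J f φ)
    {p q : ℕ} (hJ : IsLocallyMetallic p q J) {X : Π x : M₁, TangentSpace 𝓘(ℝ, E₁) x}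
    (Z : Π x : M₂, TangentSpace 𝓘(ℝ, E₂) x) (x : M₁ × M₂)
    (hX : ContMDiff 𝓘(ℝ, E₁) (𝓘(ℝ, E₁).prod 𝓘(ℝ, E₁)) ∞
      (fun x : M₁ ↦ (TotalSpace.mk' E₁ x (X x) : TangentBundle 𝓘(ℝ, E₁) M₁))) :
    let JX : Π y : M₁ × M₂, TangentSpace 𝓘(ℝ, E) (φ y) := fun y ↦
      J (φ y) (mfderiv (𝓘(ℝ, E₁).prod 𝓘(ℝ, E₂)) 𝓘(ℝ, E) φ y (liftFst X y))
    let z : TangentSpace (𝓘(ℝ, E₁).prod 𝓘(ℝ, E₂)) x := liftSnd Z x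
    let A := shapeOperator (𝓘(ℝ, E₁).prod 𝓘(ℝ, E₂)) φ JX x z
    opT (𝓘(ℝ, E₁).prod 𝓘(ℝ, E₂)) φ J x A - (p : ℝ) • A =
        -opt (𝓘(ℝ, E₁).prod 𝓘(ℝ, E₂)) φ J x
          (normalConnection (𝓘(ℝ, E₁).prod 𝓘(ℝ, E₂)) φ JX x z) ↔
      mvfderiv 𝓘(ℝ, E₁) f x.1 (X x.1) = 0 ∨ Z x.2 = 0 := by
  intro JX z A
  have hJX : JX = fun y ↦ J (φ y) (push E₁ E₂ E φ y (X y.1) 0) :=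
    funext fun y ↦ congrArg (fun u ↦ J (φ y) (mfderiv (𝓘(ℝ, E₁).prod 𝓘(ℝ, E₂)) 𝓘(ℝ, E) φ y u))
      (liftFst_eq X y)
  have hz : z = tangentPair x 0 (Z x.2) := liftSnd_eq Z x
  have key := hφ.shapeOperator_sum_eq hJ x (mdifferentiableAt_alongCoord_id hX x.1) (Z x.2)
  simp only [← hJX, ← hz] at key
  rw [eq_neg_iff_add_eq_zero, ← Submodule.coe_eq_zero, key, neg_eq_zero, smul_eq_zero,
    hφ.push_snd_eq_zero_iff, mul_eq_zero, div_eq_zero_iff]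
  have hq : (q : ℝ) ≠ 0 := Nat.cast_ne_zero.2 hJ.q_pos.ne'
  have hf := (hφ.warping_pos x.1).ne'
  simp [hq, hf]

end Warped

end MetallicGeometry

end

/-! ### From the pointwise condition to constancy of the warping function. -/

theorem propositionp2
    {E₁ : Type*} [NormedAddCommGroup E₁] [NormedSpace ℝ E₁] [FiniteDimensional ℝ E₁]
    {E₂ : Type*} [NormedAddCommGroup E₂] [NormedSpace ℝ E₂] [FiniteDimensional ℝ E₂] [Nontrivial E₂]
    {E : Type*} [NormedAddCommGroup E] [NormedSpace ℝ E] [FiniteDimensional ℝ E]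
    -- the base `M_⊥`
    {M₁ : Type*} [TopologicalSpace M₁] [T2Space M₁] [ChartedSpace E₁ M₁] [IsManifold 𝓘(ℝ, E₁) ∞ M₁]
    [RiemannianBundle (fun x : M₁ ↦ TangentSpace 𝓘(ℝ, E₁) x)]
    [IsContMDiffRiemannianBundle 𝓘(ℝ, E₁) ∞ E₁ (fun x : M₁ ↦ TangentSpace 𝓘(ℝ, E₁) x)]
    -- the fibre `M_T`
    {M₂ : Type*} [TopologicalSpace M₂] [T2Space M₂] [ChartedSpace E₂ M₂] [IsManifold 𝓘(ℝ, E₂) ∞ M₂]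
    [Nonempty M₂]
    [RiemannianBundle (fun x : M₂ ↦ TangentSpace 𝓘(ℝ, E₂) x)]
    [IsContMDiffRiemannianBundle 𝓘(ℝ, E₂) ∞ E₂ (fun x : M₂ ↦ TangentSpace 𝓘(ℝ, E₂) x)]
    -- the ambient manifold
    {M : Type*} [TopologicalSpace M] [T2Space M] [ChartedSpace E M] [IsManifold 𝓘(ℝ, E) ∞ M]
    [RiemannianBundle (fun x : M ↦ TangentSpace 𝓘(ℝ, E) x)]
    [IsContMDiffRiemannianBundle 𝓘(ℝ, E) ∞ E (fun x : M ↦ TangentSpace 𝓘(ℝ, E) x)]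
    (p q : ℕ) (J : Π x : M, TangentSpace 𝓘(ℝ, E) x →L[ℝ] TangentSpace 𝓘(ℝ, E) x)
    (hJ : MetallicGeometry.IsLocallyMetallic p q J)
    (f : M₁ → ℝ) (φ : M₁ × M₂ → M)
    (hφ : MetallicGeometry.IsWarpedSemiInvariant E₁ E₂ J f φ) :
    (∀ x y : M₁, y ∈ connectedComponent x → f y = f x) ↔
      ∀ (X : Π x : M₁, TangentSpace 𝓘(ℝ, E₁) x) (Z : Π x : M₂, TangentSpace 𝓘(ℝ, E₂) x),
        ContMDiff 𝓘(ℝ, E₁) (𝓘(ℝ, E₁).prod 𝓘(ℝ, E₁)) ∞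
          (fun x : M₁ ↦ (TotalSpace.mk' E₁ x (X x) : TangentBundle 𝓘(ℝ, E₁) M₁)) →
        ContMDiff 𝓘(ℝ, E₂) (𝓘(ℝ, E₂).prod 𝓘(ℝ, E₂)) ∞
          (fun x : M₂ ↦ (TotalSpace.mk' E₂ x (Z x) : TangentBundle 𝓘(ℝ, E₂) M₂)) →
        ∀ x : M₁ × M₂,
          -- the vector field `J X` along the submanifold, and the vector `Z` at `x`
          let JX : Π y : M₁ × M₂, TangentSpace 𝓘(ℝ, E) (φ y) := fun y ↦
            J (φ y) (mfderiv (𝓘(ℝ, E₁).prod 𝓘(ℝ, E₂)) 𝓘(ℝ, E) φ y (MetallicGeometry.liftFst X y))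
          let z : TangentSpace (𝓘(ℝ, E₁).prod 𝓘(ℝ, E₂)) x := MetallicGeometry.liftSnd Z x
          let A := MetallicGeometry.shapeOperator (𝓘(ℝ, E₁).prod 𝓘(ℝ, E₂)) φ JX x z
          MetallicGeometry.opT (𝓘(ℝ, E₁).prod 𝓘(ℝ, E₂)) φ J x A - (p : ℝ) • A =
            -MetallicGeometry.opt (𝓘(ℝ, E₁).prod 𝓘(ℝ, E₂)) φ J x
              (MetallicGeometry.normalConnection (𝓘(ℝ, E₁).prod 𝓘(ℝ, E₂)) φ JX x z) := by
  constructor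
  · intro h X Z hX _ x
    refine (hφ.shapeOperator_condition_iff hJ Z x hX).2 (Or.inl ?_)
    rw [MetallicGeometry.mvfderiv_eq_zero_of_connectedComponent h]
    rfl
  · intro h
    have hd : ∀ x, mvfderiv 𝓘(ℝ, E₁) f x = 0 := by
      intro x
      ext v
      obtain ⟨X, hXx, hX⟩ := MetallicGeometry.exists_contMDiff_vectorField x v
      obtain ⟨y⟩ := ‹Nonempty M₂›
      -- A field `Z` that is nonzero at `y` rules out the alternative `Z = 0`, leaving `df(v) = 0`.
      obtain ⟨w, hw⟩ := exists_ne (0 : E₂)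
      obtain ⟨Z, hZy, hZ⟩ :=
        MetallicGeometry.exists_contMDiff_vectorField y (show TangentSpace 𝓘(ℝ, E₂) y from w)
      rcases (hφ.shapeOperator_condition_iff hJ Z (x, y) hX).1 (h X Z hX hZ (x, y)) with h0 | h0
      · exact (congrArg (mvfderiv 𝓘(ℝ, E₁) f x) hXx).symm.trans h0
      · exact absurd (hZy.symm.trans h0) hw
    intro x y hy
    exact (MetallicGeometry.isLocallyConstant_of_mvfderiv_eq_zero hφ.smooth_warping
      hd).apply_eq_of_isPreconnected isPreconnected_connectedComponent hy mem_connectedComponent
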